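/- Let $X$ be a complex Banach space and let $A_1,\dots,A_n$ be linear operators in $X$ such that $iA_1,\dots,iA_n$ are commuting generators of bounded $C_0$-groups on $X$ (that is, each $iA_j$ generates a bounded $C_0$-group $(T_j(t))_{t\in\mathbb{R}}$, and $T_j(s)T_k(t)=T_k(t)T_j(s)$ for all $j,k,s,t$). For a multi-index $\eta$ put $A^\eta=A_1^{\eta_1}\cdots A_n^{\eta_n}$. Let $P_i(x)=\sum_{|\eta|\le d}P_{\eta,i}\,x^\eta$ ($i=1,2$), with $P_{\eta,i}\in\mathbb{C}^{m,m}$, be polynomial matrices in $x\in\mathbb{R}^n$ such that $P_2(x)$ is an invertible matrix for every $x\in\mathbb{R}^n$, and let $\alpha>0$. Then the operators $P_i(A)=\sum_{|\eta|\le d}P_{\eta,i}A^\eta$ (with natural domains) are closable on $X^m$. Denote their closures by $\overline{P_i(A)}$. There is a dense subset $X_{\alpha,m}$ of $X^m$ such that, for every $\vec x\in X_{\alpha,m}$, the problem $$\mathbf{D}_t^\alpha\,\overline{P_2(A)}\,\vec u(t)=\overline{P_2(A)}\,\mathbf{D}_t^\alpha\vec u(t)=\overline{P_1(A)}\,\vec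 u(t)\quad(t\ge 0),\qquad \vec u(0)=\vec x,\quad \vec u^{(j)}(0)=0\quad(1\le j\le\lceil\alpha\rceil-1)$$ has a unique solution $\vec u:[0,\infty)\to X^m$, where a solution is a function for which all the terms are well defined and all the equalities hold. Furthermore, $\vec u$ extends to a function $\vec u:\mathbb{C}\to X^m$ such that (i) $z\mapsto\vec u(z)$ is analytic on $\mathbb{C}\setminus(-\infty,0]$; (ii) if $\alpha\in\mathbb{N}$, then $z\mapsto\vec u(z)$ is entire. Here $\mathbf{D}_t^\alpha$ is the Caputo derivative: with $g_\zeta(t)=t^{\zeta-1}/\Gamma(\zeta)$ for $\zeta>0$, $g_0$ the Dirac distribution and $(f*g)(t)=\int_0^t f(t-s)g(s)\,ds$, it is defined for those $u\in C^{\lceil\alpha\rceil-1}([0,\infty):X^m)$ for which $g_{\lceil\alpha\rceil-\alpha}*\bigl(u-\sum_{j=0}^{\lceil\alpha\rceil-1}u^{(j)}(0)g_{j+1}\bigr)\in C^{\lceil\alpha\rceil}([0,\infty):X^m)$, and $$\mathbf{D}_t^\alpha u(t)=\frac{d^{\lceil\alpha\rceil}}{dt^{\lceil\alpha\rceil}}\Bigl[g_{\lceil\alpha\rceil-\alpha}*\Bigl(u-\sum_{j=0}^{\lceil\alpha\rceil-1}u^{(j)}(0)g_{j+1}\Bigr)\Bigr](t).$$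 -/

import Mathlib

open Set Filter Topology

noncomputable section

namespace DegenerateFractional

section Operators

variable {X : Type*} [NormedAddCommGroup X] [NormedSpace ℂ X]

/-- A bounded strongly continuous group `(T t)`, `t ∈ ℝ`, of bounded linear operators on `X`. -/
structure IsBoundedC0Group (T : ℝ → X →L[ℂ] X) : Prop where
  zero : T 0 = 1
  add : ∀ s t : ℝ, T (s + t) = T s * T t
  continuous : ∀ x : X, Continuous fun t : ℝ => T t x
  bounded : ∃ M : ℝ, ∀ t : ℝ, ‖T t‖ ≤ M

/-- The (possibly unbounded) operator `B` is the generator of the group `T`: `x ∈ D(B)` and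
`B x = y` if and only if `(T t x - x) / t → y` as `t → 0`. -/
def IsGenerator (B : X →ₗ.[ℂ] X) (T : ℝ → X →L[ℂ] X) : Prop :=
  ∀ x y : X, (x, y) ∈ B.graph ↔
    Tendsto (fun t : ℝ => (t⁻¹ : ℝ) • (T t x - x)) (𝓝[≠] 0) (𝓝 y)

/-- `B 0, …, B (n-1)` are commuting generators of bounded `C₀`-groups: each one generates a bounded
`C₀`-group, and the members of these groups commute with each other. -/
def AreCommutingGenerators {n : ℕ} (B : Fin n → X →ₗ.[ℂ] X) : Prop :=
  ∃ T : Fin n → ℝ → X →L[ℂ] X,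
    (∀ j, IsBoundedC0Group (T j) ∧ IsGenerator (B j) (T j)) ∧
    ∀ j k s t, Commute (T j s) (T k t)

/-- The composition `B C` of unbounded operators with its natural domain
`{x ∈ D(C) | C x ∈ D(B)}`. -/
def opComp (B C : X →ₗ.[ℂ] X) : X →ₗ.[ℂ] X where
  domain :=
    { carrier := {x | ∃ h : x ∈ C.domain, C ⟨x, h⟩ ∈ B.domain}
      zero_mem' := ⟨C.domain.zero_mem, by
        have : C ⟨0, C.domain.zero_mem⟩ = 0 := C.map_zero
        rw [this]; exact B.domain.zero_mem⟩
      add_mem' := by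
        rintro x y ⟨hx, hx'⟩ ⟨hy, hy'⟩
        refine ⟨C.domain.add_mem hx hy, ?_⟩
        have : C ⟨x + y, C.domain.add_mem hx hy⟩ = C ⟨x, hx⟩ + C ⟨y, hy⟩ :=
          C.map_add ⟨x, hx⟩ ⟨y, hy⟩
        rw [this]; exact B.domain.add_mem hx' hy'
      smul_mem' := by
        rintro c x ⟨hx, hx'⟩
        refine ⟨C.domain.smul_mem c hx, ?_⟩
        have : C ⟨c • x, C.domain.smul_mem c hx⟩ = c • C ⟨x, hx⟩ :=
          C.map_smul c ⟨x, hx⟩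
        rw [this]; exact B.domain.smul_mem c hx' }
  toFun :=
    { toFun := fun x => B ⟨C ⟨x, x.2.fst⟩, x.2.snd⟩
      map_add' := by
        intro x y
        rw [← B.map_add]
        congr 1
        exact Subtype.ext (C.map_add ⟨x, x.2.fst⟩ ⟨y, y.2.fst⟩)
      map_smul' := by
        intro c x
        rw [RingHom.id_apply, ← B.map_smul]
        congr 1
        exact Subtype.ext (C.map_smul c ⟨x, x.2.fst⟩) }

/-- The identity operator, with domain the whole space. -/
def opId : X →ₗ.[ℂ] X := (LinearMap.id : X →ₗ[ℂ] X).toPMap ⊤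

/-- The powers of an unbounded operator, with their natural domains. -/
def opPow (B : X →ₗ.[ℂ] X) : ℕ → X →ₗ.[ℂ] X
  | 0 => opId
  | k + 1 => opComp B (opPow B k)

/-- `A ^ η = A₁ ^ η₁ ⋯ Aₙ ^ ηₙ` for a multi-index `η`. -/
def opMonomial {n : ℕ} (A : Fin n → X →ₗ.[ℂ] X) (η : Fin n → ℕ) : X →ₗ.[ℂ] X :=
  (List.ofFn fun j => opPow (A j) (η j)).foldr opComp opId

/-- For a complex matrix `M` and an operator `B` in `X`, the operator `M B` in `X ^ m`, with domain
`D(B) ^ m` and `(M B x) i = ∑ j, M i j • B (x j)`. -/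
def matrixOp {m : ℕ} (M : Matrix (Fin m) (Fin m) ℂ) (B : X →ₗ.[ℂ] X) :
    (Fin m → X) →ₗ.[ℂ] (Fin m → X) where
  domain := Submodule.pi univ fun _ => B.domain
  toFun :=
    { toFun := fun x i => ∑ j, M i j • B ⟨x.1 j, x.2 j (mem_univ j)⟩
      map_add' := by
        intro x y
        funext i
        simp only [Pi.add_apply]
        rw [← Finset.sum_add_distrib]
        refine Finset.sum_congr rfl fun j _ => ?_
        rw [← smul_add, ← B.map_add]
        rfl
      map_smul' := by
        intro c x
        funext i
        simp only [RingHom.id_apply, Pi.smul_apply]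
        rw [Finset.smul_sum]
        refine Finset.sum_congr rfl fun j _ => ?_
        rw [smul_comm c]
        exact congrArg _ (B.map_smul c ⟨x.1 j, x.2 j (mem_univ j)⟩) }

end Operators

section PolynomialMatrices

/-- The multi-indices `η ∈ ℕ₀ⁿ` with `|η| ≤ d`. -/
def multiIndices (n d : ℕ) : Finset (Fin n → ℕ) :=
  (Fintype.piFinset fun _ => Finset.range (d + 1)).filter fun η => ∑ j, η j ≤ d

/-- The value `P(x) = ∑_{|η| ≤ d} x ^ η P_η` at `x ∈ ℝⁿ` of a polynomial matrix with coefficient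
matrices `P_η`. -/
def polyMatrixEval {n m : ℕ} (d : ℕ) (P : (Fin n → ℕ) → Matrix (Fin m) (Fin m) ℂ)
    (x : Fin n → ℝ) : Matrix (Fin m) (Fin m) ℂ :=
  ∑ η ∈ multiIndices n d, (∏ j, (x j : ℂ) ^ η j) • P η

/-- The operator `P(A) = ∑_{|η| ≤ d} P_η A ^ η` in `X ^ m`, a sum of unbounded operators with
its natural domain. -/
def polyMatrixOp {X : Type*} [NormedAddCommGroup X] [NormedSpace ℂ X] {n m : ℕ} (d : ℕ)
    (P : (Fin n → ℕ) → Matrix (Fin m) (Fin m) ℂ) (A : Fin n → X →ₗ.[ℂ] X) :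
    (Fin m → X) →ₗ.[ℂ] (Fin m → X) :=
  ∑ η ∈ multiIndices n d, matrixOp (P η) (opMonomial A η)

end PolynomialMatrices

section Caputo

variable {E : Type*} [NormedAddCommGroup E] [NormedSpace ℝ E]

/-- `(g_β * f)(t)` for `t ≥ 0`, where `g_β(t) = t ^ (β - 1) / Γ(β)` for `β > 0` and `g₀` is the
Dirac distribution. -/
def fracIntegral (β : ℝ) (f : ℝ → E) (t : ℝ) : E :=
  if β = 0 then f t else ∫ s in (0 : ℝ)..t, ((t - s) ^ (β - 1) / Real.Gamma β) • f s

/-- `u(t) - ∑_{j < k} u^{(j)}(0) t ^ j / j!`, with derivatives taken in `[0, ∞)`. -/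
def taylorRemainder (k : ℕ) (u : ℝ → E) (t : ℝ) : E :=
  u t - ∑ j ∈ Finset.range k,
    (t ^ j / (j.factorial : ℝ)) • iteratedDerivWithin j u (Ici 0) 0

/-- The function `g_{⌈α⌉ - α} * (u - ∑_{j < ⌈α⌉} u^{(j)}(0) g_{j+1})`. -/
def caputoKernel (α : ℝ) (u : ℝ → E) : ℝ → E :=
  fracIntegral ((⌈α⌉₊ : ℝ) - α) (taylorRemainder ⌈α⌉₊ u)

/-- The Caputo derivative of order `α > 0` of `u : [0, ∞) → E` is defined. Only the values of `u`
on `[0, ∞)` matter. -/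
def CaputoDifferentiable (α : ℝ) (u : ℝ → E) : Prop :=
  ContDiffOn ℝ ((⌈α⌉₊ - 1 : ℕ) : WithTop ℕ∞) u (Ici 0) ∧
    ContDiffOn ℝ (⌈α⌉₊ : WithTop ℕ∞) (caputoKernel α u) (Ici 0)

/-- The Caputo derivative of order `α > 0` at `t ≥ 0`. -/
def caputoDeriv (α : ℝ) (u : ℝ → E) (t : ℝ) : E :=
  iteratedDerivWithin ⌈α⌉₊ (caputoKernel α u) (Ici 0) t

end Caputo

/-- `u : [0, ∞) → E` solves the problem
`D_t^α B₂ u(t) = B₂ D_t^α u(t) = B₁ u(t)` for `t ≥ 0`, `u(0) = x` and `u^{(j)}(0) = 0` for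
`1 ≤ j ≤ ⌈α⌉ - 1`, all the terms being well defined. Here `v` and `w` are the functions
`B₂ u` and `B₁ u`. Only the values of `u` on `[0, ∞)` matter. -/
def IsSolution {E : Type*} [NormedAddCommGroup E] [NormedSpace ℂ E] (α : ℝ)
    (B₁ B₂ : E →ₗ.[ℂ] E) (x : E) (u : ℝ → E) : Prop :=
  CaputoDifferentiable α u ∧
  (∃ v w : ℝ → E,
    (∀ t, 0 ≤ t → (u t, v t) ∈ B₂.graph) ∧
    (∀ t, 0 ≤ t → (u t, w t) ∈ B₁.graph) ∧
    CaputoDifferentiable α v ∧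
    (∀ t, 0 ≤ t → caputoDeriv α v t = w t) ∧
    (∀ t, 0 ≤ t → (caputoDeriv α u t, w t) ∈ B₂.graph)) ∧
  u 0 = x ∧
  ∀ j : ℕ, 1 ≤ j → j ≤ ⌈α⌉₊ - 1 → iteratedDerivWithin j u (Ici 0) 0 = 0

end DegenerateFractional

end

/-! The commuting groups assemble into a bounded representation `R` of ℝⁿ, formally `R ξ = exp(-2πi
ξ·A)`. Fourier inversion then suggests `φ(A) = ∫ 𝓕⁻ φ(ξ) R ξ dξ` for smooth compactly supported `φ`,
and this is a multiplicative calculus of bounded operators (`calc_mul`). It contains an approximate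
identity (`exists_approximate_identity`), so the vectors `φ(A) y` are dense and a vector killed by
every `φ(A)` is zero.

An unbounded operator has symbol `G` when the range of every `Φ(A)` lies in its domain, where it
acts as left multiplication of `Φ` by `G`, and when applying `Φ(A)` after it amounts to right
multiplication by `G`. The order matters for matrices. Symbols respect composition, sums and matrix
coefficients, so `P(A)` has symbol `P(ξ)`. The second clause survives closure of the graph, which
gives closability (`HasSymbolM.isClosable`) and the same symbol for the closure.

On the support of a test function `φ` the degenerate equation becomes a regular one: if `ψ = 1`
there, `M = (ψ P₂⁻¹ P₁)(A)` is bounded and plays the role of `P₂(A)⁻¹ P₁(A)` on the range of `φ(A)`.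
With vanishing higher initial derivatives, the Caputo problem is equivalent to a Volterra equation
with kernel `g_α` (`CaputoDifferentiable.eqOn_add_fracIntegral`, `caputo_of_eqOn_add_fracIntegral`).
Hence `φ(A) E_α(t^α M) y` is a solution with initial value `φ(A) y` (`isSolution_mittagLeffler`).
The difference of two solutions, hit with any `φ(A)`, solves a homogeneous Volterra equation with
bounded `M` and vanishes by iteration (`IsSolution.eqOn`). The extension is analytic because `E_α`
is entire and `z ^ α` is analytic off the cut, and entire for integer `α`. -/

noncomputable section

namespace DegenerateFractional

open MeasureTheory FourierTransform
open scoped ContDiff SchwartzMap LineDeriv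

/-! ### Riemann–Liouville fractional integrals and their semigroup law. -/

section FractionalIntegrals

/-- The kernel `g_β(x) = x ^ (β - 1) / Γ(β)`. -/
def rlKernel (β x : ℝ) : ℝ := x ^ (β - 1) / Real.Gamma β

/-- Translated to `r = 0`, this is Euler's Beta integral, evaluated over ℂ and brought back to ℝ; it
is the convolution law of the kernels. -/
theorem integral_rlKernel_mul_rlKernel {a b : ℝ} (ha : 0 < a) (hb : 0 < b) {r t : ℝ} (hrt : r < t) :
    ∫ s in r..t, rlKernel a (t - s) * rlKernel b (s - r) = rlKernel (a + b) (t - r) := by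
  have h0 : 0 < t - r := sub_pos.2 hrt
  have h1 : ∫ s in r..t, rlKernel a (t - s) * rlKernel b (s - r) =
      ∫ x in (0 : ℝ)..(t - r), rlKernel a (t - r - x) * rlKernel b x := by
    rw [← sub_self r, ← intervalIntegral.integral_comp_sub_right
      (fun x => rlKernel a (t - r - x) * rlKernel b x) r]
    refine intervalIntegral.integral_congr fun s _ => ?_
    simp only [sub_sub_sub_cancel_right]
  have hB := Complex.betaIntegral_scaled (b : ℂ) (a : ℂ) h0
  have hG := Complex.Gamma_mul_Gamma_eq_betaIntegral (s := (b : ℂ)) (t := (a : ℂ))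
    (by simpa using hb) (by simpa using ha)
  have hGab : Complex.Gamma ((b : ℂ) + a) ≠ 0 := by
    rw [← Complex.ofReal_add, Complex.Gamma_ofReal]
    exact_mod_cast (Real.Gamma_pos_of_pos (add_pos hb ha)).ne'
  rw [h1]
  apply Complex.ofReal_injective
  rw [← intervalIntegral.integral_ofReal]
  have h2 : ∫ x in (0 : ℝ)..(t - r), ((rlKernel a (t - r - x) * rlKernel b x : ℝ) : ℂ) =
      ((Real.Gamma a * Real.Gamma b : ℝ) : ℂ)⁻¹ * ∫ x in (0 : ℝ)..(t - r),
        (x : ℂ) ^ ((b : ℂ) - 1) * (((t - r : ℝ) : ℂ) - x) ^ ((a : ℂ) - 1) := by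
    rw [← intervalIntegral.integral_const_mul]
    refine intervalIntegral.integral_congr fun x hx => ?_
    rw [uIcc_of_le h0.le] at hx
    have e1 : (x : ℂ) ^ ((b : ℂ) - 1) = ((x ^ (b - 1) : ℝ) : ℂ) := by
      rw [Complex.ofReal_cpow hx.1]; push_cast; rfl
    have e2 : (((t - r : ℝ) : ℂ) - x) ^ ((a : ℂ) - 1) = (((t - r - x) ^ (a - 1) : ℝ) : ℂ) := by
      rw [Complex.ofReal_cpow (sub_nonneg.2 hx.2)]; push_cast; rfl
    simp only [e1, e2, rlKernel]
    push_cast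
    ring
  rw [h2, hB]
  have h3 : Complex.betaIntegral b a = Complex.Gamma b * Complex.Gamma a / Complex.Gamma (b + a) := by
    rw [hG]; field_simp
  rw [h3, rlKernel]
  have e3 : ((t - r : ℝ) : ℂ) ^ ((b : ℂ) + a - 1) = (((t - r) ^ (a + b - 1) : ℝ) : ℂ) := by
    rw [Complex.ofReal_cpow h0.le]; push_cast; rw [add_comm (a : ℂ)]
  have ga : Complex.Gamma a ≠ 0 := by
    rw [Complex.Gamma_ofReal]; exact_mod_cast (Real.Gamma_pos_of_pos ha).ne'
  have gb : Complex.Gamma b ≠ 0 := by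
    rw [Complex.Gamma_ofReal]; exact_mod_cast (Real.Gamma_pos_of_pos hb).ne'
  rw [e3]
  push_cast
  rw [← Complex.Gamma_ofReal, ← Complex.Gamma_ofReal, ← Complex.Gamma_ofReal]
  push_cast
  rw [add_comm (b : ℂ)]
  rw [add_comm (b : ℂ)] at hGab
  field_simp

theorem rlKernel_nonneg {β x : ℝ} (hβ : 0 < β) (hx : 0 ≤ x) : 0 ≤ rlKernel β x :=
  div_nonneg (Real.rpow_nonneg hx _) (Real.Gamma_pos_of_pos hβ).le

theorem measurable_rlKernel (β : ℝ) : Measurable (rlKernel β) := by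
  unfold rlKernel
  fun_prop

theorem intervalIntegrable_rlKernel {β : ℝ} (hβ : 0 < β) (t : ℝ) :
    IntervalIntegrable (fun s => rlKernel β (t - s)) volume 0 t := by
  have h : IntervalIntegrable (fun s : ℝ => rlKernel β s) volume 0 t :=
    (intervalIntegral.intervalIntegrable_rpow' (by linarith)).div_const _
  simpa using (h.comp_sub_left t).symm

variable {E : Type*} [NormedAddCommGroup E] [NormedSpace ℝ E]

theorem fracIntegral_zero_order (f : ℝ → E) (t : ℝ) : fracIntegral 0 f t = f t := if_pos rfl

theorem fracIntegral_of_pos {β : ℝ} (hβ : 0 < β) (f : ℝ → E) (t : ℝ) :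
    fracIntegral β f t = ∫ s in (0 : ℝ)..t, rlKernel β (t - s) • f s := if_neg hβ.ne'

theorem fracIntegral_congr {β : ℝ} {f g : ℝ → E} (h : EqOn f g (Ici 0)) :
    EqOn (fracIntegral β f) (fracIntegral β g) (Ici 0) := by
  intro t ht
  unfold fracIntegral
  split_ifs
  · exact h ht
  · refine intervalIntegral.integral_congr fun s hs => ?_
    rw [uIcc_of_le ht] at hs
    simp only [h hs.1]

theorem fracIntegral_apply_zero {β : ℝ} (hβ : 0 < β) (f : ℝ → E) : fracIntegral β f 0 = 0 := by
  rw [fracIntegral_of_pos hβ, intervalIntegral.integral_same]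

theorem exists_continuous_eqOn {E : Type*} [TopologicalSpace E] {f : ℝ → E} (hf : ContinuousOn f (Ici 0)) :
    ∃ g : ℝ → E, Continuous g ∧ EqOn f g (Ici 0) :=
  ⟨fun s => f (max s 0), hf.comp_continuous (by fun_prop) fun s => le_max_right s 0,
    fun s hs => by simp only [max_eq_left (mem_Ici.1 hs)]⟩

/-- The substitution `s = t σ` moves `t` out of the endpoint and the singular kernel, so that
continuity in `t` follows by dominated convergence on a fixed interval. -/
theorem fracIntegral_eq_scaled {β : ℝ} (hβ : 0 < β) (f : ℝ → E) {t : ℝ} (ht : 0 ≤ t) :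
    fracIntegral β f t = t ^ β • ∫ σ in (0 : ℝ)..1, rlKernel β (1 - σ) • f (t * σ) := by
  rcases ht.eq_or_lt with rfl | ht
  · rw [fracIntegral_apply_zero hβ, Real.zero_rpow hβ.ne', zero_smul]
  rw [fracIntegral_of_pos hβ]
  have h := intervalIntegral.smul_integral_comp_mul_left (a := 0) (b := 1)
    (fun s => rlKernel β (t - s) • f s) t
  rw [mul_zero, mul_one] at h
  rw [← h, ← intervalIntegral.integral_smul, ← intervalIntegral.integral_smul]
  refine intervalIntegral.integral_congr fun σ hσ => ?_
  rw [uIcc_of_le zero_le_one] at hσ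
  simp only [smul_smul]
  congr 1
  have e : t - t * σ = t * (1 - σ) := by ring
  rw [rlKernel, rlKernel, e, Real.mul_rpow ht.le (sub_nonneg.2 hσ.2), Real.rpow_sub_one ht.ne']
  field_simp

theorem continuousOn_fracIntegral {β : ℝ} (hβ : 0 ≤ β) {f : ℝ → E}
    (hf : ContinuousOn f (Ici 0)) : ContinuousOn (fracIntegral β f) (Ici 0) := by
  rcases hβ.eq_or_lt with rfl | hβ
  · exact hf.congr fun t _ => fracIntegral_zero_order f t
  obtain ⟨g, hg, hfg⟩ := exists_continuous_eqOn hf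
  have hJ : EqOn (fracIntegral β f)
      (fun t => t ^ β • ∫ σ in (0 : ℝ)..1, rlKernel β (1 - σ) • g (t * σ)) (Ici 0) := fun t ht => by
    rw [fracIntegral_congr hfg ht, fracIntegral_eq_scaled hβ g ht]
  refine ContinuousOn.congr ?_ hJ
  refine (Real.continuous_rpow_const hβ.le).continuousOn.smul (Continuous.continuousOn ?_)
  rw [continuous_iff_continuousAt]
  intro t₀
  obtain ⟨C, hC⟩ := (isCompact_closedBall (0 : ℝ) (|t₀| + 1)).exists_bound_of_continuousOn
    hg.continuousOn
  refine intervalIntegral.continuousAt_of_dominated_interval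
    (bound := fun σ => ‖rlKernel β (1 - σ)‖ * C) ?_ ?_ ?_ ?_
  · refine Eventually.of_forall fun t => ?_
    refine AEStronglyMeasurable.smul ?_ (hg.comp (by fun_prop)).aestronglyMeasurable
    exact ((measurable_rlKernel β).comp (by fun_prop)).aestronglyMeasurable
  · filter_upwards [Metric.ball_mem_nhds t₀ one_pos] with t ht
    refine Eventually.of_forall fun σ hσ => ?_
    rw [uIoc_of_le zero_le_one] at hσ
    rw [norm_smul]
    gcongr
    refine hC _ ?_
    rw [mem_closedBall_zero_iff, norm_mul]
    have h1 : ‖t‖ ≤ |t₀| + 1 := by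
      have := norm_sub_norm_le t t₀
      rw [Metric.mem_ball, dist_eq_norm] at ht
      rw [Real.norm_eq_abs t₀] at this
      linarith
    have h2 : ‖σ‖ ≤ 1 := by rw [Real.norm_eq_abs, abs_of_pos hσ.1]; exact hσ.2
    calc ‖t‖ * ‖σ‖ ≤ ‖t‖ * 1 := by gcongr
      _ ≤ _ := by rwa [mul_one]
  · exact (intervalIntegrable_rlKernel hβ 1).norm.mul_const C
  · exact Eventually.of_forall fun σ _ => by fun_prop

theorem intervalIntegrable_rlKernel_smul {β : ℝ} (hβ : 0 < β) {f : ℝ → E}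
    (hf : ContinuousOn f (Ici 0)) {t : ℝ} (ht : 0 ≤ t) :
    IntervalIntegrable (fun s => rlKernel β (t - s) • f s) volume 0 t := by
  refine (intervalIntegrable_rlKernel hβ t).smul_continuousOn (hf.mono ?_)
  rw [uIcc_of_le ht]
  exact fun s hs => hs.1

theorem fracIntegral_one {f : ℝ → E} (t : ℝ) :
    fracIntegral 1 f t = ∫ s in (0 : ℝ)..t, f s := by
  rw [fracIntegral_of_pos one_pos]
  simp [rlKernel]

theorem fracIntegral_add {β : ℝ} (hβ : 0 ≤ β) {f g : ℝ → E} (hf : ContinuousOn f (Ici 0))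
    (hg : ContinuousOn g (Ici 0)) {t : ℝ} (ht : 0 ≤ t) :
    fracIntegral β (fun s => f s + g s) t = fracIntegral β f t + fracIntegral β g t := by
  rcases hβ.eq_or_lt with rfl | hβ
  · simp only [fracIntegral_zero_order]
  simp only [fracIntegral_of_pos hβ, smul_add]
  exact intervalIntegral.integral_add (intervalIntegrable_rlKernel_smul hβ hf ht)
    (intervalIntegrable_rlKernel_smul hβ hg ht)

theorem fracIntegral_sub {β : ℝ} (hβ : 0 ≤ β) {f g : ℝ → E} (hf : ContinuousOn f (Ici 0))
    (hg : ContinuousOn g (Ici 0)) {t : ℝ} (ht : 0 ≤ t) :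
    fracIntegral β (fun s => f s - g s) t = fracIntegral β f t - fracIntegral β g t := by
  rcases hβ.eq_or_lt with rfl | hβ
  · simp only [fracIntegral_zero_order]
  simp only [fracIntegral_of_pos hβ, smul_sub]
  exact intervalIntegral.integral_sub (intervalIntegrable_rlKernel_smul hβ hf ht)
    (intervalIntegrable_rlKernel_smul hβ hg ht)

theorem fracIntegral_clm {F : Type*} [NormedAddCommGroup F] [NormedSpace ℝ F] [CompleteSpace E]
    [CompleteSpace F] (L : E →L[ℝ] F) {β : ℝ} (hβ : 0 ≤ β) {f : ℝ → E}
    (hf : ContinuousOn f (Ici 0)) {t : ℝ} (ht : 0 ≤ t) :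
    fracIntegral β (fun s => L (f s)) t = L (fracIntegral β f t) := by
  rcases hβ.eq_or_lt with rfl | hβ
  · simp only [fracIntegral_zero_order]
  simp only [fracIntegral_of_pos hβ, ← L.map_smul]
  exact L.intervalIntegral_comp_comm (intervalIntegrable_rlKernel_smul hβ hf ht)

theorem fracIntegral_const [CompleteSpace E] {β : ℝ} (hβ : 0 ≤ β) (c : E) {t : ℝ} (ht : 0 ≤ t) :
    fracIntegral β (fun _ => c) t = (t ^ β / Real.Gamma (β + 1)) • c := by
  rcases hβ.eq_or_lt with rfl | hβ
  · simp [fracIntegral_zero_order]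
  rw [fracIntegral_of_pos hβ, intervalIntegral.integral_smul_const]
  congr 1
  rcases ht.eq_or_lt with rfl | ht
  · simp [Real.zero_rpow hβ.ne']
  have h := integral_rlKernel_mul_rlKernel hβ one_pos ht
  simpa [rlKernel] using h

/-- Fubini on the triangle `r ≤ s ≤ t`, where the inner integral of the two kernels is the Beta
integral. -/
theorem fracIntegral_fracIntegral_of_pos [CompleteSpace E] {a b : ℝ} (ha : 0 < a) (hb : 0 < b)
    {f : ℝ → E} (hf : Continuous f) {t : ℝ} (ht : 0 ≤ t) :
    fracIntegral a (fracIntegral b f) t = fracIntegral (a + b) f t := by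
  set μ : Measure ℝ := volume.restrict (Ioc 0 t) with hμ
  let k : ℝ → ℝ → ℝ := fun s r =>
    if r ≤ s then rlKernel a (t - s) * rlKernel b (s - r) else 0
  have hslice : ∀ r ∈ Ioo 0 t, ∀ φ : ℝ → ℝ, ∫ s, (if r ≤ s then φ s else 0) ∂μ =
      ∫ s in r..t, φ s := by
    intro r hr φ
    have e : (fun s => if r ≤ s then φ s else 0) = (Ici r).indicator φ := by
      ext s; simp [indicator]
    rw [e, hμ, setIntegral_indicator measurableSet_Ici, intervalIntegral.integral_of_le hr.2.le,
      ← integral_Icc_eq_integral_Ioc]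
    congr 2
    ext s
    simp only [mem_inter_iff, mem_Ioc, mem_Ici, mem_Icc]
    exact ⟨fun h => ⟨h.2, h.1.2⟩, fun h => ⟨⟨hr.1.trans_le h.1, h.2⟩, h.1⟩⟩
  have hae : ∀ᵐ r ∂μ, r ∈ Ioo 0 t := by
    rw [hμ, ae_restrict_iff' measurableSet_Ioc]
    filter_upwards [Measure.ae_ne volume t] with r hr hr'
    exact ⟨hr'.1, lt_of_le_of_ne hr'.2 hr⟩
  have hkint : ∀ r ∈ Ioo 0 t, ∫ s, k s r ∂μ = rlKernel (a + b) (t - r) := fun r hr => by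
    rw [← integral_rlKernel_mul_rlKernel ha hb hr.2]
    exact hslice r hr _
  have hknn : ∀ᵐ s ∂μ, ∀ r, 0 ≤ k s r := by
    rw [hμ, ae_restrict_iff' measurableSet_Ioc]
    refine Eventually.of_forall fun s hs r => ?_
    simp only [k]
    split_ifs with h
    · exact mul_nonneg (rlKernel_nonneg ha (sub_nonneg.2 hs.2)) (rlKernel_nonneg hb (sub_nonneg.2 h))
    · exact le_rfl
  have hkmeas : Measurable (Function.uncurry k) := by
    refine Measurable.ite (measurableSet_le measurable_snd measurable_fst) ?_ measurable_const
    exact ((measurable_rlKernel a).comp (by fun_prop)).mul ((measurable_rlKernel b).comp (by fun_prop))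
  have hmeas : AEStronglyMeasurable (Function.uncurry fun s r => k s r • f r) (μ.prod μ) :=
    hkmeas.aestronglyMeasurable.smul (hf.comp continuous_snd).aestronglyMeasurable
  have hint : Integrable (Function.uncurry fun s r => k s r • f r) (μ.prod μ) := by
    rw [integrable_prod_iff' hmeas]
    constructor
    · filter_upwards [hae] with r hr
      refine Integrable.smul_const ?_ (f r)
      -- A slice that is not integrable would have integral `0` by convention, but its value is the
      -- positive number `rlKernel (a + b) (t - r)`.
      by_contra hcon
      have := hkint r hr
      rw [integral_undef hcon] at this
      have hpos : 0 < rlKernel (a + b) (t - r) :=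
        div_pos (Real.rpow_pos_of_pos (sub_pos.2 hr.2) _) (Real.Gamma_pos_of_pos (add_pos ha hb))
      linarith
    · have h1 : Integrable (fun r => rlKernel (a + b) (t - r) * ‖f r‖) μ := by
        have := intervalIntegrable_rlKernel_smul (add_pos ha hb) hf.norm.continuousOn ht
        rw [intervalIntegrable_iff_integrableOn_Ioc_of_le ht] at this
        exact this
      refine h1.congr ?_
      filter_upwards [hae] with r hr
      rw [← hkint r hr, ← integral_mul_const]
      refine integral_congr_ae ?_
      filter_upwards [hknn] with s hs
      simp only [Function.uncurry, norm_smul, Real.norm_of_nonneg (hs r)]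
  have hswap := integral_integral_swap hint
  rw [fracIntegral_of_pos ha, fracIntegral_of_pos (add_pos ha hb),
    intervalIntegral.integral_of_le ht, intervalIntegral.integral_of_le ht]
  calc ∫ s in Ioc 0 t, rlKernel a (t - s) • fracIntegral b f s
      = ∫ s, ∫ r, k s r • f r ∂μ ∂μ := by
        refine setIntegral_congr_fun measurableSet_Ioc fun s hs => ?_
        rw [fracIntegral_of_pos hb, intervalIntegral.integral_of_le hs.1.le, ← integral_smul]
        have e : (fun r => k s r • f r) =
            (Iic s).indicator fun r => rlKernel a (t - s) • rlKernel b (s - r) • f r := by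
          ext r
          by_cases h : r ≤ s <;> simp [k, h, smul_smul]
        rw [e, hμ, setIntegral_indicator measurableSet_Iic]
        congr 2
        ext r
        simp only [mem_inter_iff, mem_Ioc, mem_Iic]
        exact ⟨fun h => ⟨⟨h.1, h.2.trans hs.2⟩, h.2⟩, fun h => ⟨h.1.1, h.2⟩⟩
    _ = ∫ r, ∫ s, k s r • f r ∂μ ∂μ := hswap
    _ = ∫ r, rlKernel (a + b) (t - r) • f r ∂μ := by
        refine integral_congr_ae ?_
        filter_upwards [hae] with r hr
        rw [integral_smul_const, hkint r hr]

theorem fracIntegral_fracIntegral [CompleteSpace E] {a b : ℝ} (ha : 0 ≤ a) (hb : 0 ≤ b)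
    {f : ℝ → E} (hf : ContinuousOn f (Ici 0)) :
    EqOn (fracIntegral a (fracIntegral b f)) (fracIntegral (a + b) f) (Ici 0) := by
  intro t ht
  rcases ha.eq_or_lt with rfl | ha
  · rw [fracIntegral_zero_order, zero_add]
  rcases hb.eq_or_lt with rfl | hb
  · rw [add_zero]
    exact fracIntegral_congr (fun s _ => fracIntegral_zero_order f s) ht
  obtain ⟨g, hg, hfg⟩ := exists_continuous_eqOn hf
  rw [fracIntegral_congr (fracIntegral_congr hfg) ht, fracIntegral_congr hfg ht]
  exact fracIntegral_fracIntegral_of_pos ha hb hg ht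

end FractionalIntegrals

/-! ### Equivalence of the Caputo problem with a Volterra equation. -/

section CaputoCalculus

variable {E : Type*} [NormedAddCommGroup E] [NormedSpace ℝ E]

theorem taylorRemainder_eq {k : ℕ} (hk : 0 < k) {u : ℝ → E}
    (h0 : ∀ j, 1 ≤ j → j ≤ k - 1 → iteratedDerivWithin j u (Ici 0) 0 = 0) :
    taylorRemainder k u = fun t => u t - u 0 := by
  funext t
  unfold taylorRemainder
  rw [Finset.sum_eq_single_of_mem 0 (Finset.mem_range.2 hk)]
  · simp
  · intro j hj hj0
    rw [h0 j (by omega) (by have := Finset.mem_range.1 hj; omega), smul_zero]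

theorem iteratedDerivWithin_sub_const {f : ℝ → E} (c : E) (j : ℕ) (hj : 1 ≤ j) :
    iteratedDerivWithin j (fun t => f t - c) (Ici 0) = iteratedDerivWithin j f (Ici 0) := by
  obtain ⟨k, rfl⟩ : ∃ k, j = k + 1 := ⟨j - 1, by omega⟩
  rw [iteratedDerivWithin_succ', iteratedDerivWithin_succ']
  congr 1
  funext t
  exact derivWithin_sub_const c

variable [CompleteSpace E]

/-- By the semigroup law, order `b + 1` is the ordinary primitive of order `b`, so this is the
fundamental theorem of calculus. -/
theorem hasDerivWithinAt_fracIntegral_add_one {b : ℝ} (hb : 0 ≤ b) {f : ℝ → E}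
    (hf : ContinuousOn f (Ici 0)) {t : ℝ} (ht : 0 ≤ t) :
    HasDerivWithinAt (fracIntegral (b + 1) f) (fracIntegral b f t) (Ici 0) t := by
  obtain ⟨g, hg, hfg⟩ := exists_continuous_eqOn (continuousOn_fracIntegral hb hf)
  have h1 : EqOn (fracIntegral (b + 1) f) (fun s => ∫ r in (0 : ℝ)..s, g r) (Ici 0) := fun s hs => by
    rw [add_comm, ← fracIntegral_fracIntegral zero_le_one hb hf hs, fracIntegral_congr hfg hs,
      fracIntegral_one]
  rw [hfg ht]
  exact (intervalIntegral.integral_hasDerivAt_right (hg.intervalIntegrable 0 t)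
    (hg.stronglyMeasurableAtFilter _ _) hg.continuousAt).hasDerivWithinAt.congr h1 (h1 ht)

theorem iteratedDerivWithin_fracIntegral {b : ℝ} (hb : 0 ≤ b) {f : ℝ → E}
    (hf : ContinuousOn f (Ici 0)) (j : ℕ) :
    EqOn (iteratedDerivWithin j (fracIntegral (b + j) f) (Ici 0)) (fracIntegral b f) (Ici 0) := by
  induction j with
  | zero => intro t _; simp
  | succ j ih =>
    intro t ht
    rw [iteratedDerivWithin_succ', ← ih ht]
    refine iteratedDerivWithin_congr (fun s hs => ?_) ht
    have h := hasDerivWithinAt_fracIntegral_add_one (b := b + j) (by positivity) hf hs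
    have e : b + ((j + 1 : ℕ) : ℝ) = b + j + 1 := by push_cast; ring
    rw [e]
    exact h.derivWithin (uniqueDiffOn_Ici 0 s hs)

theorem contDiffOn_fracIntegral {b : ℝ} (hb : 0 ≤ b) {f : ℝ → E} (hf : ContinuousOn f (Ici 0))
    (k : ℕ) : ContDiffOn ℝ (k : WithTop ℕ∞) (fracIntegral (b + k) f) (Ici 0) := by
  induction k with
  | zero =>
    simp only [Nat.cast_zero, add_zero]
    exact contDiffOn_zero.2 (continuousOn_fracIntegral hb hf)
  | succ k ih =>
    have e : b + ((k + 1 : ℕ) : ℝ) = b + k + 1 := by push_cast; ring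
    have h := fun t (ht : t ∈ Ici (0 : ℝ)) =>
      hasDerivWithinAt_fracIntegral_add_one (b := b + k) (by positivity) hf ht
    rw [e, Nat.cast_add, Nat.cast_one, contDiffOn_succ_iff_derivWithin (uniqueDiffOn_Ici 0)]
    refine ⟨fun t ht => (h t ht).differentiableWithinAt, fun hω => ?_, ?_⟩
    · exact absurd hω (by simp)
    · exact ih.congr fun t ht => (h t ht).derivWithin (uniqueDiffOn_Ici 0 t ht)

/-- Taylor's formula with integral remainder for vanishing initial values. -/
theorem eqOn_fracIntegral_iteratedDerivWithin (k : ℕ) {f : ℝ → E}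
    (hf : ContDiffOn ℝ (k : WithTop ℕ∞) f (Ici 0))
    (h0 : ∀ j < k, iteratedDerivWithin j f (Ici 0) 0 = 0) :
    EqOn f (fracIntegral k (iteratedDerivWithin k f (Ici 0))) (Ici 0) := by
  induction k generalizing f with
  | zero => intro t _; simp [fracIntegral_zero_order]
  | succ k ih =>
    intro t ht
    rw [Nat.cast_add, Nat.cast_one, contDiffOn_succ_iff_derivWithin (uniqueDiffOn_Ici 0)] at hf
    obtain ⟨hd, -, hc⟩ := hf
    have h := ih hc fun j hj => by
      rw [← iteratedDerivWithin_succ']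
      exact h0 (j + 1) (by omega)
    have hcont : ContinuousOn (iteratedDerivWithin k (derivWithin f (Ici 0)) (Ici 0)) (Ici 0) :=
      hc.continuousOn_iteratedDerivWithin le_rfl (uniqueDiffOn_Ici 0)
    have hsub : Icc 0 t ⊆ Ici 0 := fun s hs => hs.1
    have hftc : ∫ s in (0 : ℝ)..t, derivWithin f (Ici 0) s = f t - f 0 := by
      refine intervalIntegral.integral_eq_sub_of_hasDeriv_right_of_le ht
        (hd.continuousOn.mono hsub) (fun s hs => ?_) ?_
      · exact ((hd s hs.1.le).hasDerivWithinAt).mono fun r hr => hs.1.le.trans (mem_Ioi.1 hr).le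
      · refine ContinuousOn.intervalIntegrable ?_
        rw [uIcc_of_le ht]
        exact hc.continuousOn.mono hsub
    have hf0 : f 0 = 0 := by simpa using h0 0 (Nat.succ_pos k)
    rw [hf0, sub_zero] at hftc
    rw [← hftc, ← fracIntegral_one, fracIntegral_congr h ht, iteratedDerivWithin_succ',
      fracIntegral_fracIntegral zero_le_one (Nat.cast_nonneg k) hcont ht, Nat.cast_add,
      Nat.cast_one, add_comm]

/-- A further integration of order `⌈b⌉ - b` makes the total order an integer, and differentiating
that many times recovers the function. -/
theorem fracIntegral_injective {b : ℝ} (hb : 0 ≤ b) {f g : ℝ → E} (hf : ContinuousOn f (Ici 0))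
    (hg : ContinuousOn g (Ici 0)) (h : EqOn (fracIntegral b f) (fracIntegral b g) (Ici 0)) :
    EqOn f g (Ici 0) := by
  have hc : 0 ≤ (⌈b⌉₊ : ℝ) - b := sub_nonneg.2 (Nat.le_ceil b)
  have key : EqOn (fracIntegral ⌈b⌉₊ f) (fracIntegral ⌈b⌉₊ g) (Ici 0) := fun t ht => by
    have h1 := fracIntegral_congr (β := (⌈b⌉₊ : ℝ) - b) h ht
    rwa [fracIntegral_fracIntegral hc hb hf ht, fracIntegral_fracIntegral hc hb hg ht,
      sub_add_cancel] at h1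
  intro t ht
  have h1 := iteratedDerivWithin_fracIntegral le_rfl hf ⌈b⌉₊ ht
  have h2 := iteratedDerivWithin_fracIntegral le_rfl hg ⌈b⌉₊ ht
  rw [zero_add, fracIntegral_zero_order] at h1 h2
  rw [← h1, ← h2]
  exact iteratedDerivWithin_congr key ht

/-- The initial value problem for the Caputo derivative implies the Volterra integral equation. -/
theorem CaputoDifferentiable.eqOn_add_fracIntegral {α : ℝ} (hα : 0 < α) {u : ℝ → E}
    (hu : CaputoDifferentiable α u)
    (h0 : ∀ j, 1 ≤ j → j ≤ ⌈α⌉₊ - 1 → iteratedDerivWithin j u (Ici 0) 0 = 0) :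
    ContinuousOn (caputoDeriv α u) (Ici 0) ∧
      EqOn u (fun t => u 0 + fracIntegral α (caputoDeriv α u) t) (Ici 0) := by
  obtain ⟨hu1, hu2⟩ := hu
  have hcont : ContinuousOn (caputoDeriv α u) (Ici 0) :=
    hu2.continuousOn_iteratedDerivWithin le_rfl (uniqueDiffOn_Ici 0)
  refine ⟨hcont, ?_⟩
  have hNpos : 0 < ⌈α⌉₊ := Nat.ceil_pos.2 hα
  have hc : 0 ≤ (⌈α⌉₊ : ℝ) - α := sub_nonneg.2 (Nat.le_ceil α)
  obtain ⟨k, hk⟩ : ∃ k, ⌈α⌉₊ = k + 1 := ⟨⌈α⌉₊ - 1, by omega⟩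
  have hkr : (⌈α⌉₊ : ℝ) = k + 1 := by exact_mod_cast hk
  have hrem := taylorRemainder_eq hNpos h0
  set r : ℝ → E := fun t => u t - u 0 with hr
  have hrc : ContDiffOn ℝ (k : WithTop ℕ∞) r (Ici 0) := by
    have : ⌈α⌉₊ - 1 = k := by omega
    rw [this] at hu1
    exact hu1.sub contDiffOn_const
  have hr0 : ∀ j ≤ k, iteratedDerivWithin j r (Ici 0) 0 = 0 := by
    intro j hj
    rcases Nat.eq_zero_or_pos j with rfl | hj'
    · simp [hr]
    · rw [hr, iteratedDerivWithin_sub_const _ _ hj']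
      exact h0 j hj' (by omega)
  -- Taylor's formula writes the Caputo kernel as the `k`-fold primitive of `q`. Since `q` is
  -- continuous with `q 0 = 0`, derivatives of the kernel up to order `k = ⌈α⌉ - 1` vanish at `0`,
  -- which is what Taylor's formula at order `⌈α⌉` needs.
  set q := fracIntegral ((⌈α⌉₊ : ℝ) - α) (iteratedDerivWithin k r (Ici 0)) with hq
  have hrk : ContinuousOn (iteratedDerivWithin k r (Ici 0)) (Ici 0) :=
    hrc.continuousOn_iteratedDerivWithin le_rfl (uniqueDiffOn_Ici 0)
  have hqc : ContinuousOn q (Ici 0) := continuousOn_fracIntegral hc hrk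
  have hq0 : q 0 = 0 := by
    rcases hc.eq_or_lt with h | h
    · rw [hq, ← h, fracIntegral_zero_order]; exact hr0 k le_rfl
    · exact fracIntegral_apply_zero h _
  have hker : caputoKernel α u = fracIntegral ((⌈α⌉₊ : ℝ) - α) r := by
    unfold caputoKernel; rw [hrem]
  have hT := eqOn_fracIntegral_iteratedDerivWithin k hrc fun j hj => hr0 j hj.le
  have hkq : EqOn (caputoKernel α u) (fracIntegral k q) (Ici 0) := fun t ht => by
    rw [hker, fracIntegral_congr hT ht, fracIntegral_fracIntegral hc (Nat.cast_nonneg k) hrk ht,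
      add_comm, ← fracIntegral_fracIntegral (Nat.cast_nonneg k) hc hrk ht]
  have hk0 : ∀ j < ⌈α⌉₊, iteratedDerivWithin j (caputoKernel α u) (Ici 0) 0 = 0 := by
    intro j hj
    rw [iteratedDerivWithin_congr hkq self_mem_Ici]
    have e : (k : ℝ) = ((k - j : ℕ) : ℝ) + j := by
      rw [Nat.cast_sub (by omega)]; ring
    rw [e, iteratedDerivWithin_fracIntegral (Nat.cast_nonneg _) hqc j self_mem_Ici]
    rcases Nat.eq_zero_or_pos (k - j) with h | h
    · rw [h, Nat.cast_zero, fracIntegral_zero_order, hq0]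
    · exact fracIntegral_apply_zero (by exact_mod_cast h) _
  have hker2 := eqOn_fracIntegral_iteratedDerivWithin ⌈α⌉₊ hu2 hk0
  have hrcont : ContinuousOn r (Ici 0) := hrc.continuousOn
  -- Both sides agree after a fractional integration of order `⌈α⌉ - α`, which can be cancelled.
  have hmain : EqOn r (fracIntegral α (caputoDeriv α u)) (Ici 0) := by
    refine fracIntegral_injective hc hrcont (continuousOn_fracIntegral hα.le hcont) fun t ht => ?_
    rw [← hker, hker2 ht, fracIntegral_fracIntegral hc hα.le hcont ht, sub_add_cancel]
    rfl
  intro t ht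
  simp only [← hmain ht, hr, add_sub_cancel]

/-- The Volterra integral equation implies the initial value problem for the Caputo derivative. -/
theorem caputo_of_eqOn_add_fracIntegral {α : ℝ} (hα : 0 < α) {u g : ℝ → E} {x : E}
    (hg : ContinuousOn g (Ici 0))
    (hu : EqOn u (fun t => x + fracIntegral α g t) (Ici 0)) :
    CaputoDifferentiable α u ∧ EqOn (caputoDeriv α u) g (Ici 0) ∧ u 0 = x ∧
      ∀ j, 1 ≤ j → j ≤ ⌈α⌉₊ - 1 → iteratedDerivWithin j u (Ici 0) 0 = 0 := by
  have hNpos : 0 < ⌈α⌉₊ := Nat.ceil_pos.2 hα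
  have hc : 0 ≤ (⌈α⌉₊ : ℝ) - α := sub_nonneg.2 (Nat.le_ceil α)
  have hu0 : u 0 = x := by
    rw [hu self_mem_Ici]
    simp only [fracIntegral_apply_zero hα, add_zero]
  -- Strict positivity makes the `j`-th derivative a fractional integral of positive order `α - j`,
  -- hence zero at `0`.
  have hlt : ∀ j : ℕ, j ≤ ⌈α⌉₊ - 1 → 0 < α - j := fun j hj => by
    have : j < ⌈α⌉₊ := by omega
    exact sub_pos.2 (Nat.lt_ceil.1 this)
  have hur : EqOn (fun t => u t - x) (fracIntegral α g) (Ici 0) := fun t ht => by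
    simp only [hu ht, add_sub_cancel_left]
  have hd0 : ∀ j, 1 ≤ j → j ≤ ⌈α⌉₊ - 1 → iteratedDerivWithin j u (Ici 0) 0 = 0 := by
    intro j hj hj'
    rw [← iteratedDerivWithin_sub_const x j hj, iteratedDerivWithin_congr hur self_mem_Ici]
    have e : α = α - j + j := by ring
    rw [e, iteratedDerivWithin_fracIntegral (hlt j hj').le hg j self_mem_Ici]
    exact fracIntegral_apply_zero (hlt j hj') g
  have hker : EqOn (caputoKernel α u) (fracIntegral (0 + ⌈α⌉₊) g) (Ici 0) := fun t ht => by
    unfold caputoKernel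
    rw [taylorRemainder_eq hNpos hd0, hu0, fracIntegral_congr hur ht,
      fracIntegral_fracIntegral hc hα.le hg ht, sub_add_cancel, zero_add]
  refine ⟨⟨?_, ?_⟩, ?_, hu0, hd0⟩
  · have e : α = α - (⌈α⌉₊ - 1 : ℕ) + (⌈α⌉₊ - 1 : ℕ) := by ring
    have h := contDiffOn_fracIntegral (hlt _ le_rfl).le hg (⌈α⌉₊ - 1)
    rw [← e] at h
    exact (contDiffOn_const.add h).congr hu
  · exact (contDiffOn_fracIntegral le_rfl hg _).congr hker
  · intro t ht
    unfold caputoDeriv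
    rw [iteratedDerivWithin_congr hker ht, iteratedDerivWithin_fracIntegral le_rfl hg _ ht,
      fracIntegral_zero_order]

end CaputoCalculus

/-! ### The Mittag-Leffler function of a bounded operator and Volterra equations. -/

section MittagLeffler

/-- Only the part `x > Q` of the Gamma integral is kept, where `x ^ s ≥ Q ^ s`. As `Q` is free, this
shows that `Γ(αk + 1)` outgrows every geometric sequence. -/
theorem rpow_mul_exp_neg_le_Gamma {s Q : ℝ} (hs : 0 ≤ s) (hQ : 0 ≤ Q) :
    Q ^ s * Real.exp (-Q) ≤ Real.Gamma (s + 1) := by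
  have hint : IntegrableOn (fun x : ℝ => Real.exp (-x) * x ^ (s + 1 - 1)) (Ioi 0) :=
    Real.GammaIntegral_convergent (by linarith)
  rw [Real.Gamma_eq_integral (by linarith)]
  calc Q ^ s * Real.exp (-Q) = ∫ x in Ioi Q, Q ^ s * Real.exp (-x) := by
        rw [integral_const_mul, integral_exp_neg_Ioi]
    _ ≤ ∫ x in Ioi Q, Real.exp (-x) * x ^ (s + 1 - 1) := by
        refine setIntegral_mono_on ((integrableOn_exp_neg_Ioi Q).const_mul _)
          (hint.mono_set (Ioi_subset_Ioi hQ)) measurableSet_Ioi fun x hx => ?_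
        rw [mul_comm, add_sub_cancel_right]
        gcongr
        exact hx.le
    _ ≤ ∫ x in Ioi 0, Real.exp (-x) * x ^ (s + 1 - 1) := by
        refine setIntegral_mono_set hint ?_ (Ioi_subset_Ioi hQ).eventuallyLE
        filter_upwards [ae_restrict_mem measurableSet_Ioi] with x hx
        exact mul_nonneg (Real.exp_pos _).le (Real.rpow_nonneg (le_of_lt hx) _)

theorem summable_pow_div_Gamma {α : ℝ} (hα : 0 < α) (R : ℝ) :
    Summable fun k : ℕ => |R| ^ k / Real.Gamma (α * k + 1) := by
  -- Chosen so that `Q ^ α = 2 (|R| + 1)`: the terms are then at most `exp Q` times a geometric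
  -- sequence of ratio `1/2`.
  set Q : ℝ := (2 * (|R| + 1)) ^ α⁻¹ with hQ
  have hQ0 : 0 < Q := Real.rpow_pos_of_pos (by positivity) _
  have hQα : Q ^ α = 2 * (|R| + 1) := by
    rw [hQ, ← Real.rpow_mul (by positivity), inv_mul_cancel₀ hα.ne', Real.rpow_one]
  refine Summable.of_nonneg_of_le (fun k => ?_) (fun k => ?_)
    ((summable_geometric_of_lt_one (r := 1 / 2) (by norm_num) (by norm_num)).mul_left (Real.exp Q))
  · have := Real.Gamma_pos_of_pos (show 0 < α * k + 1 by positivity)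
    positivity
  · have h := rpow_mul_exp_neg_le_Gamma (s := α * k) (by positivity) hQ0.le
    rw [Real.rpow_mul hQ0.le, hQα, Real.rpow_natCast] at h
    have hpos : 0 < (2 * (|R| + 1)) ^ k * Real.exp (-Q) := by positivity
    calc |R| ^ k / Real.Gamma (α * k + 1) ≤ |R| ^ k / ((2 * (|R| + 1)) ^ k * Real.exp (-Q)) := by
          gcongr
      _ ≤ (|R| + 1) ^ k / ((2 * (|R| + 1)) ^ k * Real.exp (-Q)) := by
          gcongr
          linarith
      _ = Real.exp Q * (1 / 2) ^ k := by
          rw [mul_pow, Real.exp_neg, div_pow, one_pow]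
          field_simp

variable {E : Type*} [NormedAddCommGroup E]

theorem norm_fracIntegral_le [NormedSpace ℝ E] {β : ℝ} (hβ : 0 ≤ β) {f : ℝ → E} {C t : ℝ}
    (ht : 0 ≤ t) (hC : ∀ s ∈ Icc 0 t, ‖f s‖ ≤ C) :
    ‖fracIntegral β f t‖ ≤ t ^ β / Real.Gamma (β + 1) * C := by
  have h := fracIntegral_const hβ C ht
  rw [smul_eq_mul] at h
  rw [← h]
  rcases hβ.eq_or_lt with rfl | hβ
  · simpa only [fracIntegral_zero_order] using hC t ⟨ht, le_rfl⟩
  rw [fracIntegral_of_pos hβ, fracIntegral_of_pos hβ]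
  refine intervalIntegral.norm_integral_le_of_norm_le ht (Eventually.of_forall fun s hs => ?_)
    ((intervalIntegrable_rlKernel hβ t).mul_const C)
  have hk := rlKernel_nonneg hβ (sub_nonneg.2 hs.2)
  rw [norm_smul, Real.norm_of_nonneg hk]
  exact mul_le_mul_of_nonneg_left (hC s ⟨hs.1.le, hs.2⟩) hk

variable [NormedSpace ℂ E]

theorem norm_clm_pow_apply_le (M : E →L[ℂ] E) (k : ℕ) (y : E) : ‖(M ^ k) y‖ ≤ ‖M‖ ^ k * ‖y‖ := by
  induction k with
  | zero => simp
  | succ k ih =>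
    rw [pow_succ', pow_succ', mul_assoc]
    exact (M.le_opNorm _).trans (mul_le_mul_of_nonneg_left ih (norm_nonneg M))

theorem fracIntegral_complex_clm {F : Type*} [NormedAddCommGroup F] [NormedSpace ℂ F]
    [CompleteSpace E] [CompleteSpace F] (L : E →L[ℂ] F) {β : ℝ} (hβ : 0 ≤ β) {f : ℝ → E}
    (hf : ContinuousOn f (Ici 0)) {t : ℝ} (ht : 0 ≤ t) :
    fracIntegral β (fun s => L (f s)) t = L (fracIntegral β f t) :=
  fracIntegral_clm (L.restrictScalars ℝ) hβ hf ht

/-- Uniqueness for the homogeneous Volterra equation `u = g_α * (M u)` with bounded `M`. -/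
theorem eqOn_zero_of_eqOn_fracIntegral [CompleteSpace E] {α : ℝ} (hα : 0 < α) (M : E →L[ℂ] E)
    {u : ℝ → E} (hu : ContinuousOn u (Ici 0))
    (h : EqOn u (fracIntegral α fun s => M (u s)) (Ici 0)) : EqOn u (fun _ => 0) (Ici 0) := by
  -- Iterating the equation, using that bounded operators commute with fractional integration, gives
  -- a bound on `u` that tends to zero like the Mittag-Leffler terms.
  have hpow : ∀ k : ℕ, EqOn u (fracIntegral (α * k) fun s => (M ^ k) (u s)) (Ici 0) := by
    intro k
    induction k with
    | zero => intro t _; simp [fracIntegral_zero_order]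
    | succ k ih =>
      intro t ht
      have hc : ContinuousOn (fun s => M (u s)) (Ici 0) := M.continuous.comp_continuousOn hu
      rw [ih ht, fracIntegral_complex_clm _ (by positivity) hu ht, fracIntegral_congr h ht,
        fracIntegral_fracIntegral (by positivity) hα.le hc ht,
        ← fracIntegral_complex_clm _ (by positivity) hc ht]
      congr 1
      push_cast
      ring
  intro t ht
  obtain ⟨C, hC⟩ := (isCompact_Icc (a := 0) (b := t)).exists_bound_of_continuousOn
    (hu.mono fun s hs => hs.1)
  have ht0 : (0 : ℝ) ≤ t := ht
  have hlim : Tendsto (fun k : ℕ => |t ^ α * ‖M‖| ^ k / Real.Gamma (α * k + 1) * C) atTop (𝓝 0) := by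
    simpa using (summable_pow_div_Gamma hα (t ^ α * ‖M‖)).tendsto_atTop_zero.mul_const C
  have hle : ∀ k : ℕ, ‖u t‖ ≤ |t ^ α * ‖M‖| ^ k / Real.Gamma (α * k + 1) * C := by
    intro k
    rw [hpow k ht]
    refine (norm_fracIntegral_le (C := ‖M‖ ^ k * C) (by positivity) ht fun s hs => ?_).trans_eq ?_
    · exact (norm_clm_pow_apply_le M k _).trans
        (mul_le_mul_of_nonneg_left (hC s hs) (by positivity))
    · rw [abs_of_nonneg (by positivity), mul_pow, Real.rpow_mul ht0, Real.rpow_natCast]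
      ring
  exact norm_le_zero_iff.1 (ge_of_tendsto' hlim hle)

/-- The Mittag-Leffler function `E_α(z M) y` of a bounded operator `M`. -/
def mittagLeffler (α : ℝ) (M : E →L[ℂ] E) (y : E) (z : ℂ) : E :=
  ∑' k : ℕ, (z ^ k * ((Real.Gamma (α * k + 1))⁻¹ : ℝ)) • (M ^ k) y

theorem norm_mittagLeffler_term_le {α : ℝ} (hα : 0 < α) (M : E →L[ℂ] E) (y : E) {R : ℝ} {z : ℂ}
    (hz : ‖z‖ ≤ R) (k : ℕ) :
    ‖(z ^ k * ((Real.Gamma (α * k + 1))⁻¹ : ℝ)) • (M ^ k) y‖ ≤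
      |R * ‖M‖| ^ k / Real.Gamma (α * k + 1) * ‖y‖ := by
  have hG := Real.Gamma_pos_of_pos (show 0 < α * k + 1 by positivity)
  have hR : 0 ≤ R := (norm_nonneg z).trans hz
  rw [norm_smul, norm_mul, norm_pow, Complex.norm_real, Real.norm_of_nonneg (inv_pos.2 hG).le,
    abs_of_nonneg (by positivity), mul_pow]
  calc ‖z‖ ^ k * (Real.Gamma (α * k + 1))⁻¹ * ‖(M ^ k) y‖
      ≤ R ^ k * (Real.Gamma (α * k + 1))⁻¹ * (‖M‖ ^ k * ‖y‖) := by
        gcongr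
        exact norm_clm_pow_apply_le M k y
    _ = _ := by ring

theorem summable_mittagLeffler_bound {α : ℝ} (hα : 0 < α) (M : E →L[ℂ] E) (y : E) (R : ℝ) :
    Summable fun k : ℕ => |R * ‖M‖| ^ k / Real.Gamma (α * k + 1) * ‖y‖ :=
  (summable_pow_div_Gamma hα _).mul_right _

variable [CompleteSpace E]

theorem differentiable_mittagLeffler {α : ℝ} (hα : 0 < α) (M : E →L[ℂ] E) (y : E) :
    Differentiable ℂ (mittagLeffler α M y) := by
  intro z
  have h : DifferentiableOn ℂ (mittagLeffler α M y) (Metric.ball 0 (‖z‖ + 1)) :=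
    Complex.differentiableOn_tsum_of_summable_norm
      (summable_mittagLeffler_bound hα M y (‖z‖ + 1))
      (fun k => by fun_prop) Metric.isOpen_ball
      fun k w hw => norm_mittagLeffler_term_le hα M y (mem_ball_zero_iff.1 hw).le k
  exact h.differentiableAt (Metric.isOpen_ball.mem_nhds (by simp))

theorem hasSum_mittagLeffler {α : ℝ} (hα : 0 < α) (M : E →L[ℂ] E) (y : E) (z : ℂ) :
    HasSum (fun k : ℕ => (z ^ k * ((Real.Gamma (α * k + 1))⁻¹ : ℝ)) • (M ^ k) y)
      (mittagLeffler α M y z) :=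
  (Summable.of_norm_bounded (summable_mittagLeffler_bound hα M y ‖z‖)
    fun k => norm_mittagLeffler_term_le hα M y le_rfl k).hasSum

/-- `u(t) = E_α(t ^ α M) y` solves the Volterra equation `u = y + g_α * (M u)`. -/
theorem mittagLeffler_volterra {α : ℝ} (hα : 0 < α) (M : E →L[ℂ] E) (y : E) :
    EqOn (fun t : ℝ => mittagLeffler α M y ((t ^ α : ℝ) : ℂ))
      (fun t => y + fracIntegral α (fun s => M (mittagLeffler α M y ((s ^ α : ℝ) : ℂ))) t)
      (Ici 0) := by
  intro t ht
  have ht0 : (0 : ℝ) ≤ t := ht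
  -- The terms of the series are the fractional integrals of order `αk` of the constants `M ^ k y`,
  -- so the Volterra operator sends each term to the next.
  set a : ℕ → ℝ → E := fun k => fracIntegral (α * k) fun _ => (M ^ k) y with ha
  have hac : ∀ k, ContinuousOn (a k) (Ici 0) := fun k =>
    continuousOn_fracIntegral (by positivity) continuousOn_const
  have hat : ∀ k, ∀ s ∈ Ici (0 : ℝ),
      a k s = ((((s ^ α : ℝ) : ℂ)) ^ k * ((Real.Gamma (α * k + 1))⁻¹ : ℝ)) • (M ^ k) y := by
    intro k s hs
    simp only [ha]
    rw [fracIntegral_const (by positivity) _ hs, Real.rpow_mul hs, Real.rpow_natCast,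
      ← Complex.ofReal_pow, ← Complex.ofReal_mul, Complex.coe_smul, div_eq_mul_inv]
  have hstep : ∀ k, fracIntegral α (fun s => M (a k s)) t = a (k + 1) t := by
    intro k
    have h1 : EqOn (fun s => M (a k s)) (fracIntegral (α * k) fun _ => (M ^ (k + 1)) y) (Ici 0) := by
      intro s hs
      simp only [ha]
      rw [← fracIntegral_complex_clm M (by positivity) continuousOn_const hs, pow_succ']
      rfl
    rw [fracIntegral_congr h1 ht, fracIntegral_fracIntegral hα.le (by positivity)
      continuousOn_const ht]
    simp only [ha]
    congr 1
    push_cast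
    ring
  have hsum : ∀ K : ℕ, fracIntegral α (fun s => M (∑ k ∈ Finset.range K, a k s)) t =
      ∑ k ∈ Finset.range K, a (k + 1) t := by
    intro K
    induction K with
    | zero =>
      have := fracIntegral_const hα.le (0 : E) ht0
      simpa using this
    | succ K ih =>
      simp only [Finset.sum_range_succ, map_add]
      have h1 : ContinuousOn (fun s => M (∑ k ∈ Finset.range K, a k s)) (Ici 0) :=
        M.continuous.comp_continuousOn (continuousOn_finsetSum _ fun k _ => hac k)
      have h2 : ContinuousOn (fun s => M (a K s)) (Ici 0) := M.continuous.comp_continuousOn (hac K)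
      rw [fracIntegral_add hα.le h1 h2 ht, ih, hstep]
  have hlim : ∀ s ∈ Ici (0 : ℝ), Tendsto (fun K => ∑ k ∈ Finset.range K, a k s) atTop
      (𝓝 (mittagLeffler α M y ((s ^ α : ℝ) : ℂ))) := by
    intro s hs
    simp only [fun k => hat k s hs]
    exact (hasSum_mittagLeffler hα M y _).tendsto_sum_nat
  have hlim1 : Tendsto (fun K => ∑ k ∈ Finset.range K, a (k + 1) t) atTop
      (𝓝 (mittagLeffler α M y ((t ^ α : ℝ) : ℂ) - y)) := by
    have h := ((hlim t ht).comp (tendsto_add_atTop_nat 1)).sub_const y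
    refine h.congr fun K => ?_
    simp only [Function.comp_apply, Finset.sum_range_succ']
    have : a 0 t = y := by rw [hat 0 t ht]; simp
    rw [this, add_sub_cancel_right]
  -- A bound for `M` applied to any partial sum, uniform on `[0, t]` because `s ^ α ≤ t ^ α` there.
  set C : ℝ := ‖M‖ * ∑' k : ℕ, |t ^ α * ‖M‖| ^ k / Real.Gamma (α * k + 1) * ‖y‖ with hCdef
  have hlim2 : Tendsto (fun K => fracIntegral α (fun s => M (∑ k ∈ Finset.range K, a k s)) t) atTop
      (𝓝 (fracIntegral α (fun s => M (mittagLeffler α M y ((s ^ α : ℝ) : ℂ))) t)) := by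
    simp only [fracIntegral_of_pos hα]
    refine intervalIntegral.tendsto_integral_filter_of_dominated_convergence
      (fun s => rlKernel α (t - s) * C) ?_ ?_ ((intervalIntegrable_rlKernel hα t).mul_const C) ?_
    · refine Eventually.of_forall fun K => ?_
      have := intervalIntegrable_rlKernel_smul hα (M.continuous.comp_continuousOn
        (continuousOn_finsetSum (Finset.range K) fun k _ => hac k)) ht0
      rw [intervalIntegrable_iff] at this
      exact this.aestronglyMeasurable
    · refine Eventually.of_forall fun K => Eventually.of_forall fun s hs => ?_
      rw [uIoc_of_le ht0] at hs
      have hk := rlKernel_nonneg hα (sub_nonneg.2 hs.2)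
      rw [norm_smul, Real.norm_of_nonneg hk]
      refine mul_le_mul_of_nonneg_left ((M.le_opNorm _).trans ?_) hk
      refine mul_le_mul_of_nonneg_left ((norm_sum_le _ _).trans ?_) (norm_nonneg M)
      refine (Finset.sum_le_sum fun k _ => ?_).trans
        ((summable_mittagLeffler_bound hα M y (t ^ α)).sum_le_tsum _ fun k _ => ?_)
      · rw [hat k s hs.1.le]
        refine norm_mittagLeffler_term_le hα M y ?_ k
        rw [Complex.norm_real, Real.norm_of_nonneg (Real.rpow_nonneg hs.1.le _)]
        exact Real.rpow_le_rpow hs.1.le hs.2 hα.le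
      · exact (norm_nonneg _).trans (norm_mittagLeffler_term_le (z := ((t ^ α : ℝ) : ℂ)) hα M y
          (by rw [Complex.norm_real, Real.norm_of_nonneg (by positivity)]) k)
    · refine Eventually.of_forall fun s hs => ?_
      rw [uIoc_of_le ht0] at hs
      exact ((M.continuous.tendsto _).comp (hlim s hs.1.le)).const_smul _
  simp only [hsum] at hlim2
  have := tendsto_nhds_unique hlim1 hlim2
  simp only [← this, add_sub_cancel]

end MittagLeffler

/-! ### The functional calculus of a bounded representation. -/

section FunctionalCalculus

variable {V : Type*} [NormedAddCommGroup V] [InnerProductSpace ℝ V]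

/-- Smooth compactly supported symbols. -/
def IsTest (φ : V → ℂ) : Prop := ContDiff ℝ ∞ φ ∧ HasCompactSupport φ

theorem IsTest.zero : IsTest (fun _ : V => (0 : ℂ)) := ⟨contDiff_const, HasCompactSupport.zero⟩

theorem IsTest.add {φ ψ : V → ℂ} (hφ : IsTest φ) (hψ : IsTest ψ) : IsTest fun ξ => φ ξ + ψ ξ :=
  ⟨hφ.1.add hψ.1, hφ.2.add hψ.2⟩

theorem IsTest.smooth_mul {g φ : V → ℂ} (hg : ContDiff ℝ ∞ g) (hφ : IsTest φ) :
    IsTest fun ξ => g ξ * φ ξ :=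
  ⟨hg.mul hφ.1, hφ.2.mul_left⟩

theorem IsTest.mul_smooth {g φ : V → ℂ} (hφ : IsTest φ) (hg : ContDiff ℝ ∞ g) :
    IsTest fun ξ => φ ξ * g ξ :=
  ⟨hφ.1.mul hg, hφ.2.mul_right⟩

theorem IsTest.sum {ι : Type*} (s : Finset ι) {φ : ι → V → ℂ} (h : ∀ i ∈ s, IsTest (φ i)) :
    IsTest fun ξ => ∑ i ∈ s, φ i ξ := by
  classical
  induction s using Finset.induction_on with
  | empty => simpa using IsTest.zero
  | insert i s hi ih =>
    simp only [Finset.sum_insert hi]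
    exact (h i (Finset.mem_insert_self i s)).add
      (ih fun j hj => h j (Finset.mem_insert_of_mem hj))

theorem IsTest.exists_eq_one [FiniteDimensional ℝ V] {K : Set V} (hK : IsCompact K) :
    ∃ ψ : V → ℂ, IsTest ψ ∧ ∀ ξ ∈ K, ψ ξ = 1 := by
  obtain ⟨r, hr⟩ := hK.isBounded.subset_closedBall (0 : V)
  let b : ContDiffBump (0 : V) := ⟨|r| + 1, |r| + 2, by positivity, by linarith⟩
  refine ⟨fun ξ => (b ξ : ℂ), ⟨Complex.ofRealCLM.contDiff.comp b.contDiff,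
    b.hasCompactSupport.comp_left Complex.ofReal_zero⟩, fun ξ hξ => ?_⟩
  have h : ξ ∈ Metric.closedBall (0 : V) b.rIn :=
    Metric.closedBall_subset_closedBall ((le_abs_self r).trans (le_add_of_nonneg_right zero_le_one))
      (hr hξ)
  simp only [b.one_of_mem_closedBall h, Complex.ofReal_one]

/-- The Schwartz function given by a test function. -/
def IsTest.toSchwartz {φ : V → ℂ} (h : IsTest φ) : 𝓢(V, ℂ) := h.2.toSchwartzMap h.1

theorem IsTest.coe_toSchwartz {φ : V → ℂ} (h : IsTest φ) : (h.toSchwartz : V → ℂ) = φ := rfl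

variable {X : Type*} [NormedAddCommGroup X] [NormedSpace ℂ X]

/-- A bounded strongly continuous representation of the additive group of `V`. -/
structure IsBoundedRep (R : V → X →L[ℂ] X) : Prop where
  zero : R 0 = 1
  add : ∀ ξ η, R (ξ + η) = R ξ * R η
  continuous : ∀ x, Continuous fun ξ => R ξ x
  bounded : ∃ M : ℝ, ∀ ξ, ‖R ξ‖ ≤ M

variable [MeasurableSpace V] [BorelSpace V] [FiniteDimensional ℝ V]

theorem IsBoundedRep.integrable_smul {R : V → X →L[ℂ] X} (hR : IsBoundedRep R) {f : V → ℂ}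
    (hf : Integrable f) (x : X) : Integrable fun ξ => f ξ • R ξ x := by
  obtain ⟨M, hM⟩ := hR.bounded
  refine (hf.norm.mul_const (M * ‖x‖)).mono'
    (hf.aestronglyMeasurable.smul (hR.continuous x).aestronglyMeasurable)
    (Eventually.of_forall fun ξ => ?_)
  rw [norm_smul]
  gcongr
  exact (R ξ).le_of_opNorm_le (hM ξ) x

/-- The operator `x ↦ ∫ f(ξ) R(ξ) x dξ`. -/
def IsBoundedRep.integralOp {R : V → X →L[ℂ] X} (hR : IsBoundedRep R) {f : V → ℂ}
    (hf : Integrable f) : X →L[ℂ] X :=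
  LinearMap.mkContinuous
    { toFun := fun x => ∫ ξ, f ξ • R ξ x
      map_add' := fun x y => by
        simp only [map_add, smul_add]
        exact integral_add (hR.integrable_smul hf x) (hR.integrable_smul hf y)
      map_smul' := fun c x => by
        simp only [map_smul, RingHom.id_apply]
        rw [← integral_smul]
        simp only [smul_comm c] }
    ((∫ ξ, ‖f ξ‖) * hR.bounded.choose) fun x => by
      rw [mul_assoc, ← integral_mul_const]
      refine norm_integral_le_of_norm_le (hf.norm.mul_const _) (Eventually.of_forall fun ξ => ?_)
      rw [norm_smul]
      gcongr
      exact (R ξ).le_of_opNorm_le (hR.bounded.choose_spec ξ) x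

theorem IsTest.integrable_fourierInv {φ : V → ℂ} (h : IsTest φ) : Integrable (𝓕⁻ φ) := by
  rw [← h.coe_toSchwartz, ← SchwartzMap.fourierInv_coe]
  exact (𝓕⁻ h.toSchwartz).integrable

open Classical in
/-- The functional calculus of a bounded representation on test functions; it is `0` on functions
which are not test functions. -/
def IsBoundedRep.calc {R : V → X →L[ℂ] X} (hR : IsBoundedRep R) (φ : V → ℂ) : X →L[ℂ] X :=
  if h : IsTest φ then hR.integralOp h.integrable_fourierInv else 0

namespace IsBoundedRep

variable {R : V → X →L[ℂ] X} (hR : IsBoundedRep R)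

theorem calc_apply {φ : V → ℂ} (h : IsTest φ) (x : X) :
    hR.calc φ x = ∫ ξ, 𝓕⁻ φ ξ • R ξ x := by
  rw [IsBoundedRep.calc, dif_pos h]
  rfl

theorem calc_add {φ ψ : V → ℂ} (hφ : IsTest φ) (hψ : IsTest ψ) :
    hR.calc (fun ξ => φ ξ + ψ ξ) = hR.calc φ + hR.calc ψ := by
  ext x
  rw [add_apply, hR.calc_apply hφ, hR.calc_apply hψ,
    hR.calc_apply (hφ.add hψ), ← integral_add (hR.integrable_smul hφ.integrable_fourierInv x)
      (hR.integrable_smul hψ.integrable_fourierInv x)]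
  refine integral_congr_ae (Eventually.of_forall fun ξ => ?_)
  have h : 𝓕⁻ (fun ξ => φ ξ + ψ ξ) ξ = 𝓕⁻ φ ξ + 𝓕⁻ ψ ξ := by
    have e : (fun ξ => φ ξ + ψ ξ) = ((hφ.toSchwartz + hψ.toSchwartz : 𝓢(V, ℂ)) : V → ℂ) := rfl
    rw [e, ← SchwartzMap.fourierInv_coe, FourierTransform.fourierInv_add, add_apply,
      SchwartzMap.fourierInv_coe, SchwartzMap.fourierInv_coe]
    rfl
  simp only [h, add_smul]

theorem calc_zero : hR.calc (fun _ => 0) = 0 := by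
  simpa using hR.calc_add IsTest.zero IsTest.zero

theorem calc_sum {ι : Type*} (s : Finset ι) {φ : ι → V → ℂ} (h : ∀ i ∈ s, IsTest (φ i)) :
    hR.calc (fun ξ => ∑ i ∈ s, φ i ξ) = ∑ i ∈ s, hR.calc (φ i) := by
  classical
  induction s using Finset.induction_on with
  | empty => simpa using hR.calc_zero
  | insert i s hi ih =>
    simp only [Finset.sum_insert hi]
    have hs : ∀ j ∈ s, IsTest (φ j) := fun j hj => h j (Finset.mem_insert_of_mem hj)
    rw [hR.calc_add (h i (Finset.mem_insert_self i s)) (IsTest.sum s hs), ih hs]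

theorem calc_const_mul (c : ℂ) {φ : V → ℂ} (hφ : IsTest φ) :
    hR.calc (fun ξ => c * φ ξ) = c • hR.calc φ := by
  ext x
  rw [smul_apply, hR.calc_apply hφ,
    hR.calc_apply (IsTest.smooth_mul contDiff_const hφ), ← integral_smul]
  refine integral_congr_ae (Eventually.of_forall fun ξ => ?_)
  have h : 𝓕⁻ (fun ξ => c * φ ξ) ξ = c * 𝓕⁻ φ ξ := by
    have e : (fun ξ => c * φ ξ) = ((c • hφ.toSchwartz : 𝓢(V, ℂ)) : V → ℂ) := rfl
    rw [e, ← SchwartzMap.fourierInv_coe, FourierTransform.fourierInv_smul, smul_apply,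
      SchwartzMap.fourierInv_coe]
    rfl
  simp only [h, mul_smul]

variable [CompleteSpace X]

theorem apply_calc (L : X →L[ℂ] X) {φ : V → ℂ} (hφ : IsTest φ) (x : X) :
    L (hR.calc φ x) = ∫ ξ, 𝓕⁻ φ ξ • L (R ξ x) := by
  rw [hR.calc_apply hφ, ← L.integral_comp_comm (hR.integrable_smul hφ.integrable_fourierInv x)]
  simp only [map_smul]

theorem calc_commute {L : X →L[ℂ] X} (hL : ∀ ξ, Commute L (R ξ)) {φ : V → ℂ} (hφ : IsTest φ)
    (x : X) : L (hR.calc φ x) = hR.calc φ (L x) := by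
  rw [hR.apply_calc L hφ, hR.calc_apply hφ]
  refine integral_congr_ae (Eventually.of_forall fun ξ => ?_)
  exact congrArg _ (DFunLike.congr_fun (hL ξ).eq x)

/-- The inverse Fourier transform turns products into convolutions; Fubini, `R ξ = R t * R (ξ - t)`
and translation invariance then separate the two factors. -/
theorem calc_mul {φ ψ : V → ℂ} (hφ : IsTest φ) (hψ : IsTest ψ) (x : X) :
    hR.calc (fun ξ => φ ξ * ψ ξ) x = hR.calc φ (hR.calc ψ x) := by
  have hφψ : IsTest fun ξ => φ ξ * ψ ξ := hφ.mul_smooth hψ.1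
  set f := 𝓕⁻ hφ.toSchwartz with hf
  set g := 𝓕⁻ hψ.toSchwartz with hg
  have hfφ : 𝓕⁻ φ = f := by rw [hf, SchwartzMap.fourierInv_coe]; rfl
  have hgψ : 𝓕⁻ ψ = g := by rw [hg, SchwartzMap.fourierInv_coe]; rfl
  have hconv : ∀ ξ, 𝓕⁻ (fun ξ => φ ξ * ψ ξ) ξ = ∫ t, f t * g (ξ - t) := by
    intro ξ
    have h1 := SchwartzMap.convolution_apply (ContinuousLinearMap.mul ℂ ℂ) f g ξ
    have h2 : SchwartzMap.convolution (ContinuousLinearMap.mul ℂ ℂ) f g = 𝓕⁻ hφψ.toSchwartz := by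
      rw [← FourierTransform.fourierInv_fourier_eq (F := 𝓢(V, ℂ))
        (SchwartzMap.convolution (ContinuousLinearMap.mul ℂ ℂ) f g),
        SchwartzMap.fourier_convolution]
      congr 1
      ext η
      rw [SchwartzMap.pairing_apply_apply, hf, hg, FourierTransform.fourier_fourierInv_eq,
        FourierTransform.fourier_fourierInv_eq]
      rfl
    rw [h2, SchwartzMap.fourierInv_coe] at h1
    exact h1
  rw [hR.calc_apply hφψ, hR.calc_apply hφ]
  simp only [hconv, hfφ]
  have hint : Integrable (Function.uncurry fun ξ t => (f t * g (ξ - t)) • R ξ x)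
      ((volume : Measure V).prod volume) := by
    have h1 : Integrable (fun p : V × V => f p.2 * g (p.1 - p.2))
        ((volume : Measure V).prod volume) :=
      f.integrable.convolution_integrand (ContinuousLinearMap.mul ℂ ℂ) g.integrable
    obtain ⟨M, hM⟩ := hR.bounded
    refine (h1.norm.mul_const (M * ‖x‖)).mono' (h1.aestronglyMeasurable.smul
      ((hR.continuous x).comp continuous_fst).aestronglyMeasurable)
      (Eventually.of_forall fun p => ?_)
    simp only [Function.uncurry, norm_smul]
    gcongr
    exact (R p.1).le_of_opNorm_le (hM p.1) x
  calc ∫ ξ, (∫ t, f t * g (ξ - t)) • R ξ x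
      = ∫ ξ, ∫ t, (f t * g (ξ - t)) • R ξ x := by
        simp only [integral_smul_const]
    _ = ∫ t, ∫ ξ, (f t * g (ξ - t)) • R ξ x := integral_integral_swap hint
    _ = ∫ t, f t • R t (hR.calc ψ x) := by
        refine integral_congr_ae (Eventually.of_forall fun t => ?_)
        simp only [mul_smul]
        rw [integral_smul, hR.apply_calc (R t) hψ, hgψ,
          ← integral_sub_right_eq_self (fun ξ => g ξ • R t (R ξ x)) t]
        congr 1
        refine integral_congr_ae (Eventually.of_forall fun ξ => ?_)
        have : R ξ = R t * R (ξ - t) := by rw [← hR.add, add_sub_cancel]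
        simp only [this, mul_apply_eq_comp]

/-- Peetre's inequality `1 + ‖ξ‖ ≤ (1 + ‖e‖)(1 + ‖ξ - s e‖)` transfers the decay of `g` to its
translates. It supplies the dominating function for differentiation under the integral. -/
theorem _root_.SchwartzMap.exists_integrable_translate_bound (g : 𝓢(V, ℂ)) (e : V) :
    ∃ b : V → ℝ, Integrable b ∧ ∀ s : ℝ, |s| ≤ 1 → ∀ ξ, ‖g (ξ - s • e)‖ ≤ b ξ := by
  set k := Module.finrank ℝ V + 1 with hk
  have hdecay := fun η => SchwartzMap.one_add_le_sup_seminorm_apply (𝕜 := ℝ) (m := (k, 0)) (k := k)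
    (n := 0) le_rfl le_rfl g η
  set C := 2 ^ k * ((Finset.Iic (k, 0)).sup fun m => SchwartzMap.seminorm ℝ m.1 m.2) g with hC
  have hint : Integrable (fun ξ : V => (1 + ‖ξ‖) ^ (-(k : ℝ))) :=
    integrable_one_add_norm (by rw [hk]; push_cast; linarith)
  refine ⟨fun ξ => C * (1 + ‖e‖) ^ k * (1 + ‖ξ‖) ^ (-(k : ℝ)), hint.const_mul _, fun s hs ξ => ?_⟩
  have h1 : (1 + ‖ξ - s • e‖) ^ k * ‖g (ξ - s • e)‖ ≤ C := by simpa using hdecay (ξ - s • e)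
  have h2 : 1 + ‖ξ‖ ≤ (1 + ‖e‖) * (1 + ‖ξ - s • e‖) := by
    have h3 : ‖ξ‖ ≤ ‖ξ - s • e‖ + ‖s • e‖ := by simpa using norm_add_le (ξ - s • e) (s • e)
    have h4 : ‖s • e‖ ≤ ‖e‖ := by
      rw [norm_smul, Real.norm_eq_abs]
      exact mul_le_of_le_one_left (norm_nonneg e) hs
    nlinarith [norm_nonneg e, norm_nonneg (ξ - s • e)]
  simp only
  rw [Real.rpow_neg (by positivity), Real.rpow_natCast, ← div_eq_mul_inv, le_div_iff₀ (by positivity)]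
  calc ‖g (ξ - s • e)‖ * (1 + ‖ξ‖) ^ k
      ≤ ‖g (ξ - s • e)‖ * ((1 + ‖e‖) * (1 + ‖ξ - s • e‖)) ^ k := by gcongr
    _ = ((1 + ‖ξ - s • e‖) ^ k * ‖g (ξ - s • e)‖) * (1 + ‖e‖) ^ k := by rw [mul_pow]; ring
    _ ≤ C * (1 + ‖e‖) ^ k := by gcongr

/-- Translation moves `s` from the merely strongly continuous `R` onto the Schwartz function `𝓕⁻ φ`,
whose directional derivative corresponds to the factor `2πi ⟨ξ, e⟩` on the symbol. -/
theorem hasDerivAt_calc {φ : V → ℂ} (hφ : IsTest φ) (e : V) (x : X) :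
    HasDerivAt (fun s : ℝ => R (s • e) (hR.calc φ x))
      (-(2 * Real.pi * Complex.I) • hR.calc (fun ξ => (inner ℝ ξ e : ℂ) * φ ξ) x) 0 := by
  have hg : ContDiff ℝ ∞ fun ξ : V => ((inner ℝ ξ e : ℝ) : ℂ) :=
    Complex.ofRealCLM.contDiff.comp (contDiff_id.inner ℝ contDiff_const)
  have hψ : IsTest fun ξ => (inner ℝ ξ e : ℂ) * φ ξ := IsTest.smooth_mul hg hφ
  set f := 𝓕⁻ hφ.toSchwartz with hf
  have hfφ : 𝓕⁻ φ = f := by rw [hf, SchwartzMap.fourierInv_coe]; rfl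
  have hline : ∀ ξ, (∂_{e} f) ξ = (2 * Real.pi * Complex.I) *
      𝓕⁻ (fun ξ => (inner ℝ ξ e : ℂ) * φ ξ) ξ := by
    intro ξ
    have h1 : SchwartzMap.smulLeftCLM ℂ (inner ℝ · e) hφ.toSchwartz = hψ.toSchwartz := by
      have : (inner ℝ · e : V → ℝ).HasTemperateGrowth := by fun_prop
      ext η
      rw [SchwartzMap.smulLeftCLM_apply_apply this, Complex.real_smul]
      rfl
    rw [hf, SchwartzMap.lineDerivOp_fourierInv_eq, h1, FourierTransform.fourierInv_smul,
      smul_apply, SchwartzMap.fourierInv_coe, smul_eq_mul]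
    rfl
  have hG : ∀ s : ℝ, R (s • e) (hR.calc φ x) = ∫ ξ, f (ξ - s • e) • R ξ x := by
    intro s
    rw [hR.apply_calc _ hφ, hfφ, ← integral_sub_right_eq_self
      (fun ξ => f ξ • R (s • e) (R ξ x)) (s • e)]
    refine integral_congr_ae (Eventually.of_forall fun ξ => ?_)
    have : R ξ = R (s • e) * R (ξ - s • e) := by rw [← hR.add, add_sub_cancel]
    simp only [this, mul_apply_eq_comp]
  simp only [hG]
  obtain ⟨b, hb, hbound⟩ := (∂_{e} f).exists_integrable_translate_bound e
  obtain ⟨M, hM⟩ := hR.bounded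
  have hRc := hR.continuous x
  have hmain := (hasDerivAt_integral_of_dominated_loc_of_deriv_le (μ := (volume : Measure V))
    (F := fun (s : ℝ) ξ => f (ξ - s • e) • R ξ x)
    (F' := fun (s : ℝ) ξ => (-(∂_{e} f) (ξ - s • e)) • R ξ x) (x₀ := 0)
    (s := Metric.ball 0 1) (bound := fun ξ => b ξ * (M * ‖x‖)) (Metric.ball_mem_nhds 0 one_pos)
    (Eventually.of_forall fun s => ?_) ?_ ?_ ?_ (hb.mul_const _) ?_).2
  · convert hmain using 1
    rw [hR.calc_apply hψ, ← integral_smul]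
    refine integral_congr_ae (Eventually.of_forall fun ξ => ?_)
    simp only [zero_smul, sub_zero, hline]
    rw [smul_smul, neg_mul]
  · exact ((f.continuous.comp (by fun_prop)).smul hRc).aestronglyMeasurable
  · simpa using hR.integrable_smul f.integrable x
  · exact (((∂_{e} f).continuous.comp (by fun_prop)).neg.smul hRc).aestronglyMeasurable
  · refine Eventually.of_forall fun ξ s hs => ?_
    rw [norm_smul, norm_neg]
    have h1 := hbound s (by simpa using (mem_ball_zero_iff.1 hs).le) ξ
    exact mul_le_mul h1 ((R ξ).le_of_opNorm_le (hM ξ) x) (norm_nonneg _)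
      ((norm_nonneg _).trans h1)
  · refine Eventually.of_forall fun ξ s _ => HasDerivAt.smul_const ?_ _
    have h1 : HasDerivAt (fun s : ℝ => ξ - s • e) (-e) s := by
      simpa using ((hasDerivAt_id s).smul_const e).const_sub ξ
    have h2 := (f.hasFDerivAt (ξ - s • e)).comp_hasDerivAt s h1
    rw [SchwartzMap.lineDerivOp_apply_eq_fderiv]
    rw [map_neg] at h2
    exact h2

/-- Dilate one `φ` with `φ 0 = 1`. After rescaling, the integral is that of `𝓕⁻ φ(ξ) R(ξ/(k+1)) x`,
which tends to `(∫ 𝓕⁻ φ) x = φ(0) x = x` by dominated convergence. -/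
theorem exists_approximate_identity :
    ∃ φ : ℕ → V → ℂ, (∀ k, IsTest (φ k)) ∧
      ∀ x, Tendsto (fun k => hR.calc (φ k) x) atTop (𝓝 x) := by
  obtain ⟨φ, hφ, hφ1⟩ := IsTest.exists_eq_one (isCompact_singleton (x := (0 : V)))
  set c : ℕ → ℝ := fun k => ((k : ℝ) + 1)⁻¹ with hc
  have hc0 : ∀ k, 0 < c k := fun k => by positivity
  have htest : ∀ k, IsTest fun ξ => φ (c k • ξ) := fun k =>
    ⟨hφ.1.comp (contDiff_const_smul (c k)), hφ.2.comp_homeomorph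
      (Homeomorph.smulOfNeZero (c k) (hc0 k).ne')⟩
  refine ⟨fun k ξ => φ (c k • ξ), htest, fun x => ?_⟩
  have hscale : ∀ k, hR.calc (fun ξ => φ (c k • ξ)) x = ∫ ξ, 𝓕⁻ φ ξ • R (c k • ξ) x := by
    intro k
    have h1 : ∀ ξ, 𝓕⁻ (fun ξ => φ (c k • ξ)) ξ =
        |(c k ^ Module.finrank ℝ V)⁻¹| • 𝓕⁻ φ ((c k)⁻¹ • ξ) := by
      intro ξ
      rw [Real.fourierInv_eq, Real.fourierInv_eq, ← Measure.integral_comp_smul]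
      refine integral_congr_ae (Eventually.of_forall fun v => ?_)
      simp only [inner_smul_left, inner_smul_right]
      congr 3
      have := (hc0 k).ne'
      simp
      field_simp
    rw [hR.calc_apply (htest k)]
    have h2 := Measure.integral_comp_smul (volume : Measure V)
      (fun ξ => 𝓕⁻ φ ξ • R (c k • ξ) x) (c k)⁻¹
    have hpos : 0 < c k ^ Module.finrank ℝ V := pow_pos (hc0 k) _
    have h3 : ∫ ξ, 𝓕⁻ (fun ξ => φ (c k • ξ)) ξ • R ξ x = |(c k ^ Module.finrank ℝ V)⁻¹| •
        ∫ ξ, 𝓕⁻ φ ((c k)⁻¹ • ξ) • R (c k • (c k)⁻¹ • ξ) x := by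
      rw [← integral_smul]
      refine integral_congr_ae (Eventually.of_forall fun ξ => ?_)
      simp only [h1, smul_inv_smul₀ (hc0 k).ne', smul_assoc]
    rw [h3, h2, smul_smul, inv_pow (c k), inv_inv (c k ^ _), abs_of_pos (inv_pos.2 hpos),
      abs_of_pos hpos,
      inv_mul_cancel₀ hpos.ne', one_smul]
  simp only [hscale]
  have hone : ∫ ξ, 𝓕⁻ φ ξ • x = x := by
    have h1 : ∫ ξ, 𝓕⁻ φ ξ = 1 := by
      have h2 : 𝓕 (𝓕⁻ hφ.toSchwartz) 0 = φ 0 := by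
        rw [FourierTransform.fourier_fourierInv_eq]; rfl
      rw [SchwartzMap.fourier_coe, Real.fourier_eq] at h2
      simpa [SchwartzMap.fourierInv_coe, hφ.coe_toSchwartz, hφ1] using h2
    rw [integral_smul_const, h1, one_smul]
  obtain ⟨M, hM⟩ := hR.bounded
  nth_rewrite 2 [← hone]
  refine tendsto_integral_of_dominated_convergence (fun ξ => ‖𝓕⁻ φ ξ‖ * (M * ‖x‖)) (fun k => ?_)
    (hφ.integrable_fourierInv.norm.mul_const _) (fun k => Eventually.of_forall fun ξ => ?_)
    (Eventually.of_forall fun ξ => ?_)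
  · exact hφ.integrable_fourierInv.aestronglyMeasurable.smul
      ((hR.continuous x).comp (by fun_prop)).aestronglyMeasurable
  · rw [norm_smul]
    gcongr
    exact (R _).le_of_opNorm_le (hM _) x
  · refine Tendsto.const_smul ?_ _
    have h1 : Tendsto (fun k => c k • ξ) atTop (𝓝 ((0 : ℝ) • ξ)) := by
      refine Tendsto.smul_const ?_ ξ
      simpa [hc] using tendsto_one_div_add_atTop_nhds_zero_nat (𝕜 := ℝ)
    have h2 := ((hR.continuous x).tendsto ((0 : ℝ) • ξ)).comp h1
    rw [zero_smul, hR.zero] at h2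
    exact h2

end IsBoundedRep

end FunctionalCalculus

/-! ### From commuting groups to a representation of ℝⁿ. -/

section Generators

variable {X : Type*} [NormedAddCommGroup X] [NormedSpace ℂ X]

/-- Strong continuity alone need not pass to products; the uniform bound on `F` controls `F ξ (G ξ x
- G ξ₀ x)`. The pair of properties is thus fit for induction over a product. -/
theorem strongly_continuous_bounded_mul {V : Type*} [TopologicalSpace V] {F G : V → X →L[ℂ] X}
    (hF : (∀ x, Continuous fun ξ => F ξ x) ∧ ∃ M : ℝ, ∀ ξ, ‖F ξ‖ ≤ M)
    (hG : (∀ x, Continuous fun ξ => G ξ x) ∧ ∃ M : ℝ, ∀ ξ, ‖G ξ‖ ≤ M) :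
    (∀ x, Continuous fun ξ => (F * G) ξ x) ∧ ∃ M : ℝ, ∀ ξ, ‖(F * G) ξ‖ ≤ M := by
  obtain ⟨hF, M, hM⟩ := hF
  obtain ⟨hG, M', hM'⟩ := hG
  refine ⟨fun x => ?_, M * M', fun ξ => ?_⟩
  · rw [continuous_iff_continuousAt]
    intro ξ₀
    have h1 : Tendsto (fun ξ => F ξ (G ξ x - G ξ₀ x)) (𝓝 ξ₀) (𝓝 0) := by
      have h2 : Tendsto (fun ξ => M * ‖G ξ x - G ξ₀ x‖) (𝓝 ξ₀) (𝓝 0) := by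
        have h3 : Continuous fun ξ => M * ‖G ξ x - G ξ₀ x‖ :=
          continuous_const.mul ((hG x).sub continuous_const).norm
        simpa using h3.tendsto ξ₀
      exact squeeze_zero_norm (fun ξ => (F ξ).le_of_opNorm_le (hM ξ) _) h2
    have h4 := h1.add ((hF (G ξ₀ x)).tendsto ξ₀)
    rw [zero_add] at h4
    refine h4.congr fun ξ => ?_
    rw [map_sub, sub_add_cancel]
    rfl
  · exact (norm_mul_le _ _).trans (mul_le_mul (hM ξ) (hM' ξ) (norm_nonneg _)
      ((norm_nonneg _).trans (hM ξ)))

/-- Commuting bounded `C₀`-groups define a bounded representation of `ℝⁿ`, here with the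
normalization of the Fourier transform. -/
theorem exists_isBoundedRep {n : ℕ} {T : Fin n → ℝ → X →L[ℂ] X} (hT : ∀ j, IsBoundedC0Group (T j))
    (hcomm : ∀ j k s t, Commute (T j s) (T k t)) :
    ∃ R : EuclideanSpace ℝ (Fin n) → X →L[ℂ] X, IsBoundedRep R ∧
      ∀ j t, R ((-(t / (2 * Real.pi))) • EuclideanSpace.single j (1 : ℝ)) = T j t := by
  -- The factor `-2π` cancels the normalization of `𝓕⁻`, so that `A j` receives the symbol `ξ j`
  -- with no constant.
  let f : Fin n → EuclideanSpace ℝ (Fin n) → X →L[ℂ] X := fun j ξ => T j (-(2 * Real.pi) * ξ j)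
  have hf : ∀ i j, Commute (f i) (f j) := fun i j => funext fun ξ => (hcomm i j _ _).eq
  let R : EuclideanSpace ℝ (Fin n) → X →L[ℂ] X := Finset.univ.noncommProd f fun i _ j _ _ => hf i j
  let h : ∀ _ : Fin n, Multiplicative ℝ →* (X →L[ℂ] X) := fun j =>
    { toFun := fun s => T j (-(2 * Real.pi) * s.toAdd)
      map_one' := by simp [(hT j).zero]
      map_mul' := fun s t => by rw [toAdd_mul, mul_add, (hT j).add] }
  have hh : Pairwise fun i j => ∀ s t, Commute (h i s) (h j t) := fun i j _ s t => hcomm i j _ _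
  -- Seen as a homomorphism out of a product of copies of ℝ, `R` gets its group law and its values
  -- on the axes at once.
  have hRh : ∀ ξ : EuclideanSpace ℝ (Fin n), R ξ = MonoidHom.noncommPiCoprod h hh fun j => Multiplicative.ofAdd (ξ j) := by
    intro ξ
    rw [MonoidHom.noncommPiCoprod_apply]
    exact Finset.map_noncommProd Finset.univ f (fun i _ j _ _ => hf i j) (Pi.evalMonoidHom _ ξ)
  have hcb : (∀ x, Continuous fun ξ => R ξ x) ∧ ∃ M : ℝ, ∀ ξ, ‖R ξ‖ ≤ M := by
    refine Finset.noncommProd_induction Finset.univ f _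
      (fun F => (∀ x, Continuous fun ξ => F ξ x) ∧ ∃ M : ℝ, ∀ ξ, ‖F ξ‖ ≤ M)
      (fun F G hF hG => strongly_continuous_bounded_mul hF hG) ?_ fun j _ => ?_
    · exact ⟨fun x => continuous_const, ‖(1 : X →L[ℂ] X)‖, fun ξ => le_rfl⟩
    · obtain ⟨M, hM⟩ := (hT j).bounded
      exact ⟨fun x => ((hT j).continuous x).comp (by fun_prop), M, fun ξ => hM _⟩
  refine ⟨R, ⟨?_, fun ξ η => ?_, hcb.1, hcb.2⟩, fun j t => ?_⟩
  · rw [hRh]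
    exact map_one _
  · rw [hRh, hRh, hRh, ← map_mul]
    rfl
  · rw [hRh]
    have e : (fun i => Multiplicative.ofAdd
        (((-(t / (2 * Real.pi))) • EuclideanSpace.single j (1 : ℝ) : EuclideanSpace ℝ (Fin n)) i)) =
        Pi.mulSingle j (Multiplicative.ofAdd (-(t / (2 * Real.pi)))) := by
      funext i
      rcases eq_or_ne i j with rfl | hij
      · simp
      · simp [hij]
    rw [e, MonoidHom.noncommPiCoprod_mulSingle]
    change T j (-(2 * Real.pi) * -(t / (2 * Real.pi))) = T j t
    congr 1
    have := Real.pi_ne_zero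
    field_simp

theorem mem_graph_opComp {B C : X →ₗ.[ℂ] X} {x z : X} :
    (x, z) ∈ (opComp B C).graph ↔ ∃ y, (x, y) ∈ C.graph ∧ (y, z) ∈ B.graph := by
  constructor
  · intro h
    obtain ⟨w, rfl, rfl⟩ := (LinearPMap.mem_graph_iff _).1 h
    exact ⟨C ⟨w, w.2.fst⟩, C.mem_graph ⟨w, w.2.fst⟩, B.mem_graph ⟨_, w.2.snd⟩⟩
  · rintro ⟨y, hxy, hyz⟩
    obtain ⟨x', rfl, rfl⟩ := (LinearPMap.mem_graph_iff _).1 hxy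
    obtain ⟨y', hy', rfl⟩ := (LinearPMap.mem_graph_iff _).1 hyz
    have hdom : C x' ∈ B.domain := by
      have : (y' : X) = C x' := hy'
      rw [← this]; exact y'.2
    refine (LinearPMap.mem_graph_iff _).2 ⟨⟨x', x'.2, hdom⟩, rfl, ?_⟩
    exact congrArg B (Subtype.ext hy'.symm)

end Generators

/-! ### Symbols of unbounded operators, scalar and matrix valued. -/

section Symbols

variable {V : Type*} [NormedAddCommGroup V] [InnerProductSpace ℝ V] {m : ℕ}

/-- Smooth compactly supported matrix valued symbols. -/
def IsTestM (Φ : V → Matrix (Fin m) (Fin m) ℂ) : Prop :=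
  ∀ i j, IsTest fun ξ => Φ ξ i j

/-- Smooth matrix valued symbols. -/
def IsSmoothM (G : V → Matrix (Fin m) (Fin m) ℂ) : Prop :=
  ∀ i j, ContDiff ℝ ∞ fun ξ => G ξ i j

theorem IsTestM.smooth_mul {G Φ : V → Matrix (Fin m) (Fin m) ℂ}
    (hG : IsSmoothM G) (hΦ : IsTestM Φ) : IsTestM fun ξ => G ξ * Φ ξ := fun i j => by
  simp only [Matrix.mul_apply]
  exact IsTest.sum _ fun k _ => IsTest.smooth_mul (hG i k) (hΦ k j)

theorem IsTestM.mul_smooth {G Φ : V → Matrix (Fin m) (Fin m) ℂ}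
    (hΦ : IsTestM Φ) (hG : IsSmoothM G) : IsTestM fun ξ => Φ ξ * G ξ := fun i j => by
  simp only [Matrix.mul_apply]
  exact IsTest.sum _ fun k _ => IsTest.mul_smooth (hΦ i k) (hG k j)

variable [MeasurableSpace V] [BorelSpace V] [FiniteDimensional ℝ V]
variable {X : Type*} [NormedAddCommGroup X] [NormedSpace ℂ X]

namespace IsBoundedRep

variable {R : V → X →L[ℂ] X} (hR : IsBoundedRep R)

/-- The function `g` is the symbol of the unbounded operator `B`. -/
structure HasSymbol (B : X →ₗ.[ℂ] X) (g : V → ℂ) : Prop where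
  smooth : ContDiff ℝ ∞ g
  mem : ∀ φ, IsTest φ → ∀ x, (hR.calc φ x, hR.calc (fun ξ => g ξ * φ ξ) x) ∈ B.graph
  comm : ∀ φ, IsTest φ → ∀ x y, (x, y) ∈ B.graph → hR.calc φ y = hR.calc (fun ξ => g ξ * φ ξ) x

theorem hasSymbol_opId : hR.HasSymbol opId fun _ => 1 where
  smooth := contDiff_const
  mem φ hφ x := by
    simp only [one_mul]
    exact (LinearPMap.mem_graph_iff _).2 ⟨⟨_, trivial⟩, rfl, rfl⟩
  comm φ hφ x y h := by
    obtain ⟨z, hz, hz'⟩ := (LinearPMap.mem_graph_iff _).1 h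
    simp only [one_mul]
    have : x = y := hz.symm.trans hz'
    rw [this]

/-- Both clauses chain because smooth multipliers preserve test functions; range vectors therefore
lie in the natural domain of the composition. -/
theorem HasSymbol.opComp {B C : X →ₗ.[ℂ] X} {g h : V → ℂ} (hB : hR.HasSymbol B g)
    (hC : hR.HasSymbol C h) : hR.HasSymbol (opComp B C) fun ξ => g ξ * h ξ where
  smooth := hB.smooth.mul hC.smooth
  mem φ hφ x := by
    refine mem_graph_opComp.2 ⟨_, hC.mem φ hφ x, ?_⟩
    simpa only [mul_assoc] using hB.mem _ (IsTest.smooth_mul hC.smooth hφ) x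
  comm φ hφ x z hxz := by
    obtain ⟨y, hxy, hyz⟩ := mem_graph_opComp.1 hxz
    rw [hB.comm φ hφ y z hyz, hC.comm _ (IsTest.smooth_mul hB.smooth hφ) x y hxy]
    congr 2
    funext ξ
    ring

theorem HasSymbol.opPow {B : X →ₗ.[ℂ] X} {g : V → ℂ} (hB : hR.HasSymbol B g) (k : ℕ) :
    hR.HasSymbol (opPow B k) fun ξ => g ξ ^ k := by
  induction k with
  | zero =>
    simp only [pow_zero]
    exact hR.hasSymbol_opId
  | succ k ih =>
    simp only [pow_succ']
    exact hB.opComp hR ih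

theorem HasSymbol.opMonomial {n : ℕ} {A : Fin n → X →ₗ.[ℂ] X} {g : Fin n → V → ℂ}
    (hA : ∀ j, hR.HasSymbol (A j) (g j)) (η : Fin n → ℕ) :
    hR.HasSymbol (opMonomial A η) fun ξ => ∏ j, g j ξ ^ η j := by
  have h : ∀ l : List (Fin n), hR.HasSymbol
      ((l.map fun j => DegenerateFractional.opPow (A j) (η j)).foldr
        DegenerateFractional.opComp opId)
      fun ξ => (l.map fun j => g j ξ ^ η j).prod := by
    intro l
    induction l with
    | nil => simpa using hR.hasSymbol_opId
    | cons j l ih =>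
      simp only [List.map_cons, List.foldr_cons, List.prod_cons]
      exact ((hA j).opPow hR (η j)).opComp hR ih
  simp only [Fin.prod_univ_def]
  unfold DegenerateFractional.opMonomial
  rw [List.ofFn_eq_map]
  exact h _

/-- The functional calculus for matrix valued symbols. -/
def calcM (G : V → Matrix (Fin m) (Fin m) ℂ) : (Fin m → X) →L[ℂ] (Fin m → X) :=
  ContinuousLinearMap.pi fun i => ∑ j, (hR.calc fun ξ => G ξ i j) ∘L ContinuousLinearMap.proj j

theorem calcM_apply (G : V → Matrix (Fin m) (Fin m) ℂ) (x : Fin m → X) (i : Fin m) :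
    hR.calcM G x i = ∑ j, hR.calc (fun ξ => G ξ i j) (x j) := by
  simp [calcM]

theorem calcM_add {Φ Ψ : V → Matrix (Fin m) (Fin m) ℂ} (hΦ : IsTestM Φ) (hΨ : IsTestM Ψ) :
    hR.calcM (fun ξ => Φ ξ + Ψ ξ) = hR.calcM Φ + hR.calcM Ψ := by
  ext x i
  simp only [add_apply, Pi.add_apply, calcM_apply, Matrix.add_apply, ← Finset.sum_add_distrib]
  refine Finset.sum_congr rfl fun j _ => ?_
  rw [hR.calc_add (hΦ i j) (hΨ i j), add_apply]

theorem calcM_zero : hR.calcM (fun _ => (0 : Matrix (Fin m) (Fin m) ℂ)) = 0 := by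
  ext x i
  simp [calcM_apply, calc_zero]

/-- The matrix valued function `G` is the symbol of the unbounded operator `B` in `X ^ m`. -/
structure HasSymbolM (B : (Fin m → X) →ₗ.[ℂ] (Fin m → X)) (G : V → Matrix (Fin m) (Fin m) ℂ) :
    Prop where
  smooth : IsSmoothM G
  mem : ∀ Φ, IsTestM Φ → ∀ x, (hR.calcM Φ x, hR.calcM (fun ξ => G ξ * Φ ξ) x) ∈ B.graph
  comm : ∀ Φ, IsTestM Φ → ∀ x y, (x, y) ∈ B.graph →
    hR.calcM Φ y = hR.calcM (fun ξ => Φ ξ * G ξ) x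

theorem hasSymbolM_zero : hR.HasSymbolM (0 : (Fin m → X) →ₗ.[ℂ] (Fin m → X)) fun _ => 0 where
  smooth i j := contDiff_const
  mem Φ hΦ x := by
    simp only [zero_mul, calcM_zero]
    exact (LinearPMap.mem_graph_iff _).2 ⟨⟨_, trivial⟩, rfl, rfl⟩
  comm Φ hΦ x y h := by
    obtain ⟨z, hz, hz'⟩ := (LinearPMap.mem_graph_iff _).1 h
    have : y = 0 := hz'.symm
    simp only [mul_zero, calcM_zero, this, map_zero, zero_apply]

theorem HasSymbolM.add {B C : (Fin m → X) →ₗ.[ℂ] (Fin m → X)}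
    {G H : V → Matrix (Fin m) (Fin m) ℂ} (hB : hR.HasSymbolM B G) (hC : hR.HasSymbolM C H) :
    hR.HasSymbolM (B + C) fun ξ => G ξ + H ξ where
  smooth i j := (hB.smooth i j).add (hC.smooth i j)
  mem Φ hΦ x := by
    obtain ⟨b, hb, hb'⟩ := (LinearPMap.mem_graph_iff _).1 (hB.mem Φ hΦ x)
    obtain ⟨c, hc, hc'⟩ := (LinearPMap.mem_graph_iff _).1 (hC.mem Φ hΦ x)
    have hbc : (b : Fin m → X) = c := hb.trans hc.symm
    refine (LinearPMap.mem_graph_iff _).2 ⟨⟨b, b.2, hbc ▸ c.2⟩, hb, ?_⟩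
    simp only [add_mul]
    rw [hR.calcM_add (hΦ.smooth_mul hB.smooth) (hΦ.smooth_mul hC.smooth), LinearPMap.add_apply,
      add_apply]
    refine congrArg₂ _ hb' ((congrArg C (Subtype.ext ?_)).trans hc')
    exact hbc
  comm Φ hΦ x y h := by
    obtain ⟨z, rfl, rfl⟩ := (LinearPMap.mem_graph_iff _).1 h
    simp only [mul_add]
    rw [hR.calcM_add (hΦ.mul_smooth hB.smooth) (hΦ.mul_smooth hC.smooth), LinearPMap.add_apply,
      map_add, add_apply, hB.comm Φ hΦ _ _ (B.mem_graph ⟨z, z.2.1⟩),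
      hC.comm Φ hΦ _ _ (C.mem_graph ⟨z, z.2.2⟩)]

theorem HasSymbolM.sum {ι : Type*} (s : Finset ι) {B : ι → (Fin m → X) →ₗ.[ℂ] (Fin m → X)}
    {G : ι → V → Matrix (Fin m) (Fin m) ℂ} (h : ∀ i, hR.HasSymbolM (B i) (G i)) :
    hR.HasSymbolM (∑ i ∈ s, B i) fun ξ => ∑ i ∈ s, G i ξ := by
  classical
  induction s using Finset.induction_on with
  | empty => simpa using hR.hasSymbolM_zero
  | insert i s hi ih =>
    simp only [Finset.sum_insert hi]
    exact (h i).add hR ih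

theorem HasSymbol.matrixOp {B : X →ₗ.[ℂ] X} {g : V → ℂ} (hB : hR.HasSymbol B g)
    (M : Matrix (Fin m) (Fin m) ℂ) : hR.HasSymbolM (matrixOp M B) fun ξ => g ξ • M where
  smooth i j := hB.smooth.mul contDiff_const
  mem Φ hΦ x := by
    have hmem : ∀ j, (hR.calcM Φ x j, ∑ k, hR.calc (fun ξ => g ξ * Φ ξ j k) (x k)) ∈ B.graph := by
      intro j
      have h := B.graph.sum_mem (t := Finset.univ) fun k _ => hB.mem _ (hΦ j k) (x k)
      have e : ∑ k, (hR.calc (fun ξ => Φ ξ j k) (x k), hR.calc (fun ξ => g ξ * Φ ξ j k) (x k)) =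
          (hR.calcM Φ x j, ∑ k, hR.calc (fun ξ => g ξ * Φ ξ j k) (x k)) :=
        Prod.ext (by rw [Prod.fst_sum, calcM_apply]) (by rw [Prod.snd_sum])
      rwa [e] at h
    choose z hz hz' using fun j => (LinearPMap.mem_graph_iff _).1 (hmem j)
    have hdom : ∀ j, hR.calcM Φ x j ∈ B.domain := fun j => by
      have : (z j : X) = hR.calcM Φ x j := hz j
      rw [← this]; exact (z j).2
    refine (LinearPMap.mem_graph_iff _).2 ⟨⟨hR.calcM Φ x, fun j _ => hdom j⟩, rfl, ?_⟩
    funext i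
    change ∑ j, M i j • B ⟨hR.calcM Φ x j, hdom j⟩ = _
    have hB' : ∀ j, B ⟨hR.calcM Φ x j, hdom j⟩ = ∑ k, hR.calc (fun ξ => g ξ * Φ ξ j k) (x k) :=
      fun j => (congrArg B (Subtype.ext (hz j).symm)).trans (hz' j)
    simp only [hB', Finset.smul_sum]
    rw [Finset.sum_comm, calcM_apply]
    refine Finset.sum_congr rfl fun k _ => ?_
    have e : (fun ξ => ((g ξ • M) * Φ ξ) i k) = fun ξ => ∑ j, M i j * (g ξ * Φ ξ j k) := by
      funext ξ
      simp only [Matrix.mul_apply, Matrix.smul_apply, smul_eq_mul]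
      exact Finset.sum_congr rfl fun j _ => by ring
    have ht : ∀ j, IsTest fun ξ => g ξ * Φ ξ j k := fun j => IsTest.smooth_mul hB.smooth (hΦ j k)
    rw [e, hR.calc_sum _ fun j _ => IsTest.smooth_mul contDiff_const (ht j), sum_apply]
    refine Finset.sum_congr rfl fun j _ => ?_
    rw [hR.calc_const_mul _ (ht j), smul_apply]
  comm Φ hΦ x y h := by
    obtain ⟨z, rfl, rfl⟩ := (LinearPMap.mem_graph_iff _).1 h
    funext i
    rw [calcM_apply, calcM_apply]
    have hz : ∀ k, _root_.DegenerateFractional.matrixOp M B z k =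
        ∑ j, M k j • B ⟨z.1 j, z.2 j (mem_univ j)⟩ := fun k => rfl
    simp only [hz, map_sum, map_smul]
    rw [Finset.sum_comm]
    refine Finset.sum_congr rfl fun j _ => ?_
    have e : (fun ξ => (Φ ξ * (g ξ • M)) i j) = fun ξ => ∑ k, M k j * (g ξ * Φ ξ i k) := by
      funext ξ
      simp only [Matrix.mul_apply, Matrix.smul_apply, smul_eq_mul]
      exact Finset.sum_congr rfl fun j _ => by ring
    have ht : ∀ k, IsTest fun ξ => g ξ * Φ ξ i k := fun k => IsTest.smooth_mul hB.smooth (hΦ i k)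
    rw [e, hR.calc_sum _ fun k _ => IsTest.smooth_mul contDiff_const (ht k), sum_apply]
    refine Finset.sum_congr rfl fun k _ => ?_
    rw [hR.calc_const_mul _ (ht k), smul_apply, hB.comm _ (hΦ i k) _ _ (B.mem_graph ⟨z.1 j, _⟩)]

variable [CompleteSpace X]

theorem calcM_mul {Φ Ψ : V → Matrix (Fin m) (Fin m) ℂ} (hΦ : IsTestM Φ) (hΨ : IsTestM Ψ)
    (x : Fin m → X) : hR.calcM (fun ξ => Φ ξ * Ψ ξ) x = hR.calcM Φ (hR.calcM Ψ x) := by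
  funext i
  simp only [calcM_apply, map_sum]
  rw [Finset.sum_comm]
  refine Finset.sum_congr rfl fun j _ => ?_
  simp only [Matrix.mul_apply]
  rw [hR.calc_sum _ fun k _ => (hΦ i k).mul_smooth (hΨ k j).1, sum_apply]
  exact Finset.sum_congr rfl fun k _ => hR.calc_mul (hΦ i k) (hΨ k j) (x j)

end IsBoundedRep

end Symbols

/-! ### The symbols of the generators and of their polynomials. -/

section GeneratorSymbols

variable {X : Type*} [NormedAddCommGroup X] [NormedSpace ℂ X]

theorem IsBoundedRep.hasSymbolM_polyMatrixOp {n m : ℕ} {R : EuclideanSpace ℝ (Fin n) → X →L[ℂ] X}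
    (hR : IsBoundedRep R) {A : Fin n → X →ₗ.[ℂ] X} (hA : ∀ j, hR.HasSymbol (A j) fun ξ => (ξ j : ℂ))
    (d : ℕ) (P : (Fin n → ℕ) → Matrix (Fin m) (Fin m) ℂ) :
    hR.HasSymbolM (polyMatrixOp d P A) fun ξ => polyMatrixEval d P fun j => ξ j :=
  IsBoundedRep.HasSymbolM.sum hR _ fun η =>
    (IsBoundedRep.HasSymbol.opMonomial hR hA η).matrixOp hR (P η)

variable [CompleteSpace X]

/-- Differentiating `T t` on range vectors gives `i ξ j`, the chain-rule factor `-1/(2π)` meeting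
`-2πi`. For arbitrary graph vectors, `φ(A)` is passed through the difference quotient, with which it
commutes, and limits are compared. -/
theorem IsBoundedRep.hasSymbol_generator {n : ℕ} {R : EuclideanSpace ℝ (Fin n) → X →L[ℂ] X}
    (hR : IsBoundedRep R) {T : ℝ → X →L[ℂ] X} {j : Fin n}
    (hT : ∀ t, R ((-(t / (2 * Real.pi))) • EuclideanSpace.single j (1 : ℝ)) = T t)
    {A : X →ₗ.[ℂ] X} (hA : IsGenerator (Complex.I • A) T) :
    hR.HasSymbol A fun ξ => (ξ j : ℂ) := by
  have hgraph : ∀ x y, (x, y) ∈ A.graph ↔ (x, Complex.I • y) ∈ (Complex.I • A).graph := by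
    intro x y
    rw [LinearPMap.mem_graph_iff, LinearPMap.mem_graph_iff]
    refine exists_congr fun z => and_congr Iff.rfl ?_
    simp only [LinearPMap.smul_apply]
    exact (smul_right_injective X Complex.I_ne_zero).eq_iff.symm
  have hsmooth : ContDiff ℝ ∞ fun ξ : EuclideanSpace ℝ (Fin n) => (ξ j : ℂ) :=
    Complex.ofRealCLM.contDiff.comp (by fun_prop)
  have hlim : ∀ φ, IsTest φ → ∀ x, Tendsto
      (fun t : ℝ => (t⁻¹ : ℝ) • (T t (hR.calc φ x) - hR.calc φ x)) (𝓝[≠] 0)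
      (𝓝 (Complex.I • hR.calc (fun ξ => (ξ j : ℂ) * φ ξ) x)) := by
    intro φ hφ x
    have h0 := hR.hasDerivAt_calc hφ (EuclideanSpace.single j (1 : ℝ)) x
    have h1 : HasDerivAt (fun t : ℝ => -(t / (2 * Real.pi))) (-(1 / (2 * Real.pi))) 0 :=
      ((hasDerivAt_id (0 : ℝ)).div_const _).neg
    have h2 := HasDerivAt.scomp (h := fun t : ℝ => -(t / (2 * Real.pi))) (0 : ℝ)
      (by simpa using h0) h1
    have h3 := hasDerivAt_iff_tendsto_slope_zero.1 h2
    have hT0 : T 0 = 1 := by rw [← hT 0]; simp [hR.zero]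
    have e1 : ∀ t : ℝ, ((fun s : ℝ => R (s • EuclideanSpace.single j (1 : ℝ)) (hR.calc φ x)) ∘
        fun t : ℝ => -(t / (2 * Real.pi))) t = T t (hR.calc φ x) := fun t => by
      simp only [Function.comp_apply, hT]
    simp only [e1, zero_add, hT0, one_apply_eq_self] at h3
    convert h3 using 2
    rw [← neg_smul, ← Complex.coe_smul, smul_smul]
    congr 1
    · have : (Real.pi : ℂ) ≠ 0 := by exact_mod_cast Real.pi_ne_zero
      push_cast
      field_simp
    · simp [EuclideanSpace.inner_single_right]
  have hcommute : ∀ t ξ, Commute (T t) (R ξ) := fun t ξ => by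
    rw [← hT t]
    change _ * _ = _ * _
    rw [← hR.add, ← hR.add, add_comm]
  refine ⟨hsmooth, fun φ hφ x => (hgraph _ _).2 ((hA _ _).2 (hlim φ hφ x)), fun φ hφ x y hxy => ?_⟩
  have h1 := (hA _ _).1 ((hgraph _ _).1 hxy)
  have h2 := ((hR.calc φ).continuous.tendsto _).comp h1
  have h3 := tendsto_nhds_unique (h2.congr fun t => ?_) (hlim φ hφ x)
  · rw [map_smul] at h3
    exact smul_right_injective X Complex.I_ne_zero h3
  · rw [Function.comp_apply, ← Complex.coe_smul, map_smul, map_sub,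
      ← hR.calc_commute (hcommute t) hφ, Complex.coe_smul]

end GeneratorSymbols

/-! ### Inverse symbols and cutoffs. -/

section Cutoff

/-- Cramer's rule: the adjugate is polynomial in the entries and the determinant never vanishes. -/
theorem IsSmoothM.inv {V : Type*} [NormedAddCommGroup V] [InnerProductSpace ℝ V] {m : ℕ}
    {G : V → Matrix (Fin m) (Fin m) ℂ} (hG : IsSmoothM G) (hu : ∀ ξ, IsUnit (G ξ)) :
    IsSmoothM fun ξ => (G ξ)⁻¹ := by
  have hdet : ∀ {H : V → Matrix (Fin m) (Fin m) ℂ}, IsSmoothM H →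
      ContDiff ℝ ∞ fun ξ => (H ξ).det := by
    intro H hH
    simp only [Matrix.det_apply]
    exact ContDiff.sum fun σ _ => (contDiff_prod fun i _ => hH _ _).const_smul _
  intro i j
  have hadj : ContDiff ℝ ∞ fun ξ => (G ξ).adjugate i j := by
    simp only [Matrix.adjugate_apply]
    refine hdet fun k l => ?_
    simp only [Matrix.updateRow_apply]
    split_ifs
    · exact contDiff_const
    · exact hG k l
  have e : (fun ξ => (G ξ)⁻¹ i j) = fun ξ => ((G ξ).det)⁻¹ * (G ξ).adjugate i j := by
    funext ξ
    rw [Matrix.inv_def, Ring.inverse_eq_inv', Matrix.smul_apply, smul_eq_mul]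
  rw [e]
  refine ((hdet hG).inv fun ξ => ?_).mul hadj
  exact ((Matrix.isUnit_iff_isUnit_det _).1 (hu ξ)).ne_zero

/-- The cutoff `ψ` makes a smooth symbol compactly supported, hence its operator bounded, without
changing its product with `φ`. -/
theorem IsTest.exists_mul_eq {V : Type*} [NormedAddCommGroup V] [InnerProductSpace ℝ V]
    [FiniteDimensional ℝ V] {φ : V → ℂ} (hφ : IsTest φ) :
    ∃ ψ : V → ℂ, IsTest ψ ∧ ∀ ξ, φ ξ * ψ ξ = φ ξ := by
  obtain ⟨ψ, hψ, h1⟩ := IsTest.exists_eq_one hφ.2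
  refine ⟨ψ, hψ, fun ξ => ?_⟩
  by_cases hξ : ξ ∈ tsupport φ
  · rw [h1 ξ hξ, mul_one]
  · rw [image_eq_zero_of_notMem_tsupport hξ, zero_mul]

theorem IsTest.isTestM_smul {V : Type*} [NormedAddCommGroup V]
    [InnerProductSpace ℝ V] {m : ℕ} {φ : V → ℂ} (hφ : IsTest φ)
    {G : V → Matrix (Fin m) (Fin m) ℂ} (hG : IsSmoothM G) : IsTestM fun ξ => φ ξ • G ξ :=
  fun i j => hφ.mul_smooth (hG i j)

theorem IsTest.isTestM_one {V : Type*} [NormedAddCommGroup V]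
    [InnerProductSpace ℝ V] {φ : V → ℂ} (hφ : IsTest φ) (m : ℕ) :
    IsTestM fun ξ => φ ξ • (1 : Matrix (Fin m) (Fin m) ℂ) :=
  hφ.isTestM_smul fun _ _ => contDiff_const

end Cutoff

/-! ### Density, closability and the symbol of the closure. -/

namespace IsBoundedRep

variable {V : Type*} [NormedAddCommGroup V] [InnerProductSpace ℝ V] [MeasurableSpace V]
  [BorelSpace V] [FiniteDimensional ℝ V]
variable {X : Type*} [NormedAddCommGroup X] [NormedSpace ℂ X]
variable {R : V → X →L[ℂ] X} (hR : IsBoundedRep R) {m : ℕ}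

theorem calcM_smul_one (φ : V → ℂ) (x : Fin m → X) (i : Fin m) :
    hR.calcM (fun ξ => φ ξ • (1 : Matrix (Fin m) (Fin m) ℂ)) x i = hR.calc φ (x i) := by
  rw [calcM_apply, Finset.sum_eq_single_of_mem i (Finset.mem_univ i)]
  · simp
  · intro j _ hj
    simp [Matrix.one_apply_ne hj.symm, calc_zero]

variable {B : (Fin m → X) →ₗ.[ℂ] (Fin m → X)} {G : V → Matrix (Fin m) (Fin m) ℂ}

/-- The intertwining identity involves only bounded operators, so it is a closed condition on the
pair `(x, y)`. -/
theorem HasSymbolM.comm_topologicalClosure (hB : hR.HasSymbolM B G)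
    {Φ : V → Matrix (Fin m) (Fin m) ℂ} (hΦ : IsTestM Φ) {x y : Fin m → X}
    (h : (x, y) ∈ B.graph.topologicalClosure) :
    hR.calcM Φ y = hR.calcM (fun ξ => Φ ξ * G ξ) x := by
  have hcl : IsClosed {p : (Fin m → X) × (Fin m → X) |
      hR.calcM Φ p.2 = hR.calcM (fun ξ => Φ ξ * G ξ) p.1} :=
    isClosed_eq (by fun_prop) (by fun_prop)
  exact closure_minimal (fun p hp => hB.comm Φ hΦ p.1 p.2 hp) hcl h

variable [CompleteSpace X]

theorem exists_tendsto_calcM (m : ℕ) :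
    ∃ φ : ℕ → V → ℂ, (∀ k, IsTest (φ k)) ∧ ∀ x : Fin m → X, Tendsto
      (fun k => hR.calcM (fun ξ => φ k ξ • (1 : Matrix (Fin m) (Fin m) ℂ)) x) atTop (𝓝 x) := by
  obtain ⟨φ, hφ, h⟩ := hR.exists_approximate_identity
  refine ⟨φ, hφ, fun x => tendsto_pi_nhds.2 fun i => ?_⟩
  simp only [calcM_smul_one]
  exact h (x i)

theorem eq_zero_of_calcM_eq_zero {y : Fin m → X} (h : ∀ φ, IsTest φ →
    hR.calcM (fun ξ => φ ξ • (1 : Matrix (Fin m) (Fin m) ℂ)) y = 0) : y = 0 := by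
  obtain ⟨φ, hφ, hlim⟩ := hR.exists_tendsto_calcM m
  refine tendsto_nhds_unique (hlim y) ?_
  simp only [h _ (hφ _), tendsto_const_nhds]

theorem dense_range_calcM (m : ℕ) : Dense {x : Fin m → X | ∃ φ, IsTest φ ∧ ∃ y,
    hR.calcM (fun ξ => φ ξ • (1 : Matrix (Fin m) (Fin m) ℂ)) y = x} := by
  obtain ⟨φ, hφ, hlim⟩ := hR.exists_tendsto_calcM m
  exact fun x => mem_closure_of_tendsto (hlim x) (Eventually.of_forall fun k => ⟨φ k, hφ k, x, rfl⟩)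

/-- If `(0, y)` lies in the closed graph, intertwining gives `φ(A) y = 0` for every test function,
so `y = 0`. -/
theorem HasSymbolM.isClosable (hB : hR.HasSymbolM B G) : B.IsClosable := by
  refine ⟨B.graph.topologicalClosure.toLinearPMap, (Submodule.toLinearPMap_graph_eq _ ?_).symm⟩
  rintro ⟨x, y⟩ hxy (rfl : x = 0)
  refine hR.eq_zero_of_calcM_eq_zero fun φ hφ => ?_
  rw [hB.comm_topologicalClosure hR (hφ.isTestM_one m) hxy, map_zero]

theorem HasSymbolM.closure (hB : hR.HasSymbolM B G) : hR.HasSymbolM B.closure G where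
  smooth := hB.smooth
  mem Φ hΦ x := LinearPMap.le_graph_of_le B.le_closure (hB.mem Φ hΦ x)
  comm Φ hΦ x y h := by
    rw [← (hB.isClosable hR).graph_closure_eq_closure_graph] at h
    exact hB.comm_topologicalClosure hR hΦ h

end IsBoundedRep

/-! ### Uniqueness, existence and analytic extension of solutions. -/

section Solutions

variable {V : Type*} [NormedAddCommGroup V] [InnerProductSpace ℝ V] [MeasurableSpace V]
  [BorelSpace V] [FiniteDimensional ℝ V]
variable {X : Type*} [NormedAddCommGroup X] [NormedSpace ℂ X] [CompleteSpace X]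
variable {R : V → X →L[ℂ] X} (hR : IsBoundedRep R) {m : ℕ}
  {B₁ B₂ : (Fin m → X) →ₗ.[ℂ] (Fin m → X)} {G₁ G₂ : V → Matrix (Fin m) (Fin m) ℂ}

/-- Applying `(φ G₂⁻¹)(A)` to `B₂ D u = B₁ u` removes `B₂` on the left; on the right `φ G₂⁻¹ G₁ = (ψ
G₂⁻¹ G₁) φ`, since `φ` is scalar and `φ ψ = φ`. The localized equation is thus governed by a bounded
operator. -/
theorem IsSolution.calcM_caputoDeriv (h₁ : hR.HasSymbolM B₁ G₁) (h₂ : hR.HasSymbolM B₂ G₂)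
    (hu₂ : ∀ ξ, IsUnit (G₂ ξ)) {φ ψ : V → ℂ} (hφ : IsTest φ) (hψ : IsTest ψ)
    (hφψ : ∀ ξ, φ ξ * ψ ξ = φ ξ) {α : ℝ} {x : Fin m → X} {u : ℝ → Fin m → X}
    (hu : IsSolution α B₁ B₂ x u) {t : ℝ} (ht : 0 ≤ t) :
    hR.calcM (fun ξ => φ ξ • (1 : Matrix (Fin m) (Fin m) ℂ)) (caputoDeriv α u t) =
      hR.calcM (fun ξ => ψ ξ • ((G₂ ξ)⁻¹ * G₁ ξ))
        (hR.calcM (fun ξ => φ ξ • (1 : Matrix (Fin m) (Fin m) ℂ)) (u t)) := by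
  obtain ⟨-, ⟨v, w, -, hw, -, -, hD⟩, -⟩ := hu
  have hinv := h₂.smooth.inv hu₂
  have hΦ := hφ.isTestM_smul hinv
  have e₁ := h₁.comm _ hΦ _ _ (hw t ht)
  have e₂ := h₂.comm _ hΦ _ _ (hD t ht)
  have hsm : IsTestM fun ξ => ψ ξ • ((G₂ ξ)⁻¹ * G₁ ξ) := by
    have := (hψ.isTestM_smul hinv).mul_smooth h₁.smooth
    simpa only [Matrix.smul_mul] using this
  rw [← hR.calcM_mul hsm (hφ.isTestM_one m)]
  have f₂ : (fun ξ => φ ξ • (G₂ ξ)⁻¹ * G₂ ξ) = fun ξ => φ ξ • (1 : Matrix (Fin m) (Fin m) ℂ) := by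
    funext ξ
    rw [Matrix.smul_mul, Matrix.nonsing_inv_mul _ ((Matrix.isUnit_iff_isUnit_det _).1 (hu₂ ξ))]
  have f₁ : (fun ξ => φ ξ • (G₂ ξ)⁻¹ * G₁ ξ) = fun ξ =>
      ψ ξ • ((G₂ ξ)⁻¹ * G₁ ξ) * φ ξ • (1 : Matrix (Fin m) (Fin m) ℂ) := by
    funext ξ
    rw [Matrix.mul_smul, mul_one, Matrix.smul_mul, smul_smul, hφψ]
  rw [f₂] at e₂
  rw [f₁] at e₁
  rw [← e₂, e₁]

/-- Solutions are unique. -/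
theorem IsSolution.eqOn (h₁ : hR.HasSymbolM B₁ G₁) (h₂ : hR.HasSymbolM B₂ G₂)
    (hu₂ : ∀ ξ, IsUnit (G₂ ξ)) {α : ℝ} (hα : 0 < α) {x : Fin m → X} {u v : ℝ → Fin m → X}
    (hu : IsSolution α B₁ B₂ x u) (hv : IsSolution α B₁ B₂ x v) : EqOn u v (Ici 0) := by
  obtain ⟨hcu, hUu⟩ := hu.1.eqOn_add_fracIntegral hα hu.2.2.2
  obtain ⟨hcv, hUv⟩ := hv.1.eqOn_add_fracIntegral hα hv.2.2.2
  have hu0 : u 0 = x := hu.2.2.1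
  have hv0 : v 0 = x := hv.2.2.1
  have hδ : EqOn (fun t => u t - v t)
      (fracIntegral α fun t => caputoDeriv α u t - caputoDeriv α v t) (Ici 0) := fun t ht => by
    simp only [hUu ht, hUv ht, hu0, hv0, add_sub_add_left_eq_sub]
    exact (fracIntegral_sub hα.le hcu hcv ht).symm
  have hcδ : ContinuousOn (fun t => u t - v t) (Ici 0) :=
    hu.1.1.continuousOn.sub hv.1.1.continuousOn
  suffices h : ∀ t ∈ Ici (0 : ℝ), u t - v t = 0 from fun t ht => sub_eq_zero.1 (h t ht)
  intro t ht
  refine hR.eq_zero_of_calcM_eq_zero fun φ hφ => ?_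
  obtain ⟨ψ, hψ, hφψ⟩ := hφ.exists_mul_eq
  set L := hR.calcM fun ξ => φ ξ • (1 : Matrix (Fin m) (Fin m) ℂ) with hL
  refine eqOn_zero_of_eqOn_fracIntegral hα (hR.calcM fun ξ => ψ ξ • ((G₂ ξ)⁻¹ * G₁ ξ))
    (u := fun t => L (u t - v t)) (L.continuous.comp_continuousOn hcδ) (fun s hs => ?_) ht
  have e : EqOn (fun r => L (caputoDeriv α u r - caputoDeriv α v r))
      (fun r => hR.calcM (fun ξ => ψ ξ • ((G₂ ξ)⁻¹ * G₁ ξ)) (L (u r - v r))) (Ici 0) := by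
    intro r hr
    simp only [map_sub]
    rw [hu.calcM_caputoDeriv hR h₁ h₂ hu₂ hφ hψ hφψ hr, hv.calcM_caputoDeriv hR h₁ h₂ hu₂ hφ hψ hφψ hr]
  rw [← fracIntegral_congr e hs]
  exact (congrArg L (hδ hs)).trans (fracIntegral_complex_clm L hα.le (hcu.sub hcv) hs).symm

/-- The solution is given by a Mittag-Leffler function. -/
theorem isSolution_mittagLeffler (h₁ : hR.HasSymbolM B₁ G₁) (h₂ : hR.HasSymbolM B₂ G₂)
    (hu₂ : ∀ ξ, IsUnit (G₂ ξ)) {φ ψ : V → ℂ} (hφ : IsTest φ) (hψ : IsTest ψ)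
    (hφψ : ∀ ξ, φ ξ * ψ ξ = φ ξ) {α : ℝ} (hα : 0 < α) (y : Fin m → X) :
    IsSolution α B₁ B₂ (hR.calcM (fun ξ => φ ξ • (1 : Matrix (Fin m) (Fin m) ℂ)) y) fun t =>
      hR.calcM (fun ξ => φ ξ • (1 : Matrix (Fin m) (Fin m) ℂ))
        (mittagLeffler α (hR.calcM fun ξ => ψ ξ • ((G₂ ξ)⁻¹ * G₁ ξ)) y ((t ^ α : ℝ) : ℂ)) := by
  set M := hR.calcM fun ξ => ψ ξ • ((G₂ ξ)⁻¹ * G₁ ξ) with hM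
  set p : ℝ → Fin m → X := fun t => mittagLeffler α M y ((t ^ α : ℝ) : ℂ) with hp
  have hpc : Continuous p := (differentiable_mittagLeffler hα M y).continuous.comp
    (Complex.continuous_ofReal.comp (Real.continuous_rpow_const hα.le))
  have hMp : ContinuousOn (fun t => M (p t)) (Ici 0) := (M.continuous.comp hpc).continuousOn
  have hvolt := mittagLeffler_volterra hα M y
  -- Stated for every bounded `L`, because it serves twice: `φ(A)` yields the derivative of `u`, and
  -- `(G₂ φ)(A)` that of `B₂ u`.
  have hL : ∀ L : (Fin m → X) →L[ℂ] (Fin m → X), EqOn (fun t => L (p t))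
      (fun t => L y + fracIntegral α (fun s => L (M (p s))) t) (Ici 0) := fun L t ht =>
     (congrArg L (hvolt ht)).trans
      ((map_add L _ _).trans (congrArg _ (fracIntegral_complex_clm L hα.le hMp ht).symm))
  have hI := hφ.isTestM_one m
  have hinv := h₂.smooth.inv hu₂
  have hsm : IsTestM fun ξ => ψ ξ • ((G₂ ξ)⁻¹ * G₁ ξ) := by
    have := (hψ.isTestM_smul hinv).mul_smooth h₁.smooth
    simpa only [Matrix.smul_mul] using this
  -- The symbol identity `G₂ φ · ψ G₂⁻¹ G₁ = G₁ φ`; it is the differential equation at the level of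
  -- symbols.
  have hkey : ∀ z, hR.calcM (fun ξ => G₂ ξ * φ ξ • (1 : Matrix (Fin m) (Fin m) ℂ)) (M z) =
      hR.calcM (fun ξ => G₁ ξ * φ ξ • (1 : Matrix (Fin m) (Fin m) ℂ)) z := by
    intro z
    rw [hM, ← hR.calcM_mul (hI.smooth_mul h₂.smooth) hsm]
    congr 2
    funext ξ
    rw [Matrix.mul_smul, Matrix.mul_smul, Matrix.mul_smul, Matrix.smul_mul, mul_one, mul_one,
      smul_smul, Matrix.mul_nonsing_inv_cancel_left _ _
        ((Matrix.isUnit_iff_isUnit_det _).1 (hu₂ ξ)), mul_comm, hφψ]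
  obtain ⟨hu1, hu2, hu3, hu4⟩ := caputo_of_eqOn_add_fracIntegral hα
    ((hR.calcM fun ξ => φ ξ • (1 : Matrix (Fin m) (Fin m) ℂ)).continuous.comp_continuousOn hMp)
    (hL (hR.calcM fun ξ => φ ξ • (1 : Matrix (Fin m) (Fin m) ℂ)))
  obtain ⟨hv1, hv2, -, -⟩ := caputo_of_eqOn_add_fracIntegral hα
    ((hR.calcM fun ξ => G₂ ξ * φ ξ • (1 : Matrix (Fin m) (Fin m) ℂ)).continuous.comp_continuousOn hMp)
    (hL (hR.calcM fun ξ => G₂ ξ * φ ξ • (1 : Matrix (Fin m) (Fin m) ℂ)))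
  refine ⟨hu1, ⟨fun t => hR.calcM (fun ξ => G₂ ξ * φ ξ • (1 : Matrix (Fin m) (Fin m) ℂ)) (p t),
    fun t => hR.calcM (fun ξ => G₁ ξ * φ ξ • (1 : Matrix (Fin m) (Fin m) ℂ)) (p t),
    fun t _ => h₂.mem _ hI _, fun t _ => h₁.mem _ hI _, hv1, fun t ht => ?_, fun t ht => ?_⟩,
    hu3, hu4⟩
  · exact (hv2 ht).trans (hkey _)
  · rw [hu2 ht]
    have h := h₂.mem _ hI (M (p t))
    rwa [hkey] at h

/-- The analytic extension of the solutions. -/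
theorem exists_analytic_extension {E F : Type*} [NormedAddCommGroup E] [NormedSpace ℂ E]
    [CompleteSpace E] [NormedAddCommGroup F] [NormedSpace ℂ F] {α : ℝ} (hα : 0 < α)
    (L : E →L[ℂ] F) (M : E →L[ℂ] E) (y : E) :
    ∃ U : ℂ → F, (∀ t : ℝ, 0 ≤ t → U (t : ℂ) = L (mittagLeffler α M y ((t ^ α : ℝ) : ℂ))) ∧
      AnalyticOnNhd ℂ U Complex.slitPlane ∧
      ((∃ N : ℕ, α = N) → AnalyticOnNhd ℂ U univ) := by
  have hF : ∀ z, AnalyticAt ℂ (fun z => L (mittagLeffler α M y z)) z := fun z =>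
    (L.analyticAt _).comp ((differentiable_mittagLeffler hα M y).analyticAt z)
  refine ⟨fun z => L (mittagLeffler α M y (z ^ (α : ℂ))), fun t ht => ?_, fun z hz => ?_, ?_⟩
  · simp only [Complex.ofReal_cpow ht]
  · exact (hF _).comp (analyticAt_id.cpow analyticAt_const hz)
  -- For an integer exponent `z ^ α` is an honest monomial, so the branch cut disappears.
  · rintro ⟨N, rfl⟩ z -
    have e : (fun z : ℂ => z ^ ((N : ℝ) : ℂ)) = fun z => z ^ N := by
      funext z
      rw [Complex.ofReal_natCast, Complex.cpow_natCast]
    have h : AnalyticAt ℂ (fun z : ℂ => z ^ ((N : ℝ) : ℂ)) z := by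
      rw [e]
      exact analyticAt_id.pow N
    exact (hF _).comp h

end Solutions

end DegenerateFractional

end

/-! ### The main theorem. -/

theorem mainTheorem2 {X : Type*} [NormedAddCommGroup X] [NormedSpace ℂ X] [CompleteSpace X]
    (n m d : ℕ) (A : Fin n → X →ₗ.[ℂ] X)
    (hA : DegenerateFractional.AreCommutingGenerators fun j => Complex.I • A j)
    (P₁ P₂ : (Fin n → ℕ) → Matrix (Fin m) (Fin m) ℂ)
    (hP₂ : ∀ x : Fin n → ℝ, IsUnit (DegenerateFractional.polyMatrixEval d P₂ x))
    (α : ℝ) (hα : 0 < α) :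
    (DegenerateFractional.polyMatrixOp d P₁ A).IsClosable ∧
    (DegenerateFractional.polyMatrixOp d P₂ A).IsClosable ∧
    ∃ S : Set (Fin m → X), Dense S ∧ ∀ x ∈ S, ∃ u : ℝ → Fin m → X,
      DegenerateFractional.IsSolution α (DegenerateFractional.polyMatrixOp d P₁ A).closure
        (DegenerateFractional.polyMatrixOp d P₂ A).closure x u ∧
      (∀ v : ℝ → Fin m → X,
        DegenerateFractional.IsSolution α (DegenerateFractional.polyMatrixOp d P₁ A).closure
          (DegenerateFractional.polyMatrixOp d P₂ A).closure x v → EqOn v u (Ici 0)) ∧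
      ∃ U : ℂ → Fin m → X,
        (∀ t : ℝ, 0 ≤ t → U (t : ℂ) = u t) ∧
        AnalyticOnNhd ℂ U Complex.slitPlane ∧
        ((∃ N : ℕ, α = N) → AnalyticOnNhd ℂ U univ) := by
  obtain ⟨T, hT, hcomm⟩ := hA
  obtain ⟨R, hR, hRT⟩ := DegenerateFractional.exists_isBoundedRep (fun j => (hT j).1) hcomm
  have hA' : ∀ j, hR.HasSymbol (A j) fun ξ => (ξ j : ℂ) := fun j =>
    hR.hasSymbol_generator (hRT j) (hT j).2
  have h₁ := hR.hasSymbolM_polyMatrixOp hA' d P₁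
  have h₂ := hR.hasSymbolM_polyMatrixOp hA' d P₂
  have hu₂ : ∀ ξ : EuclideanSpace ℝ (Fin n),
      IsUnit (DegenerateFractional.polyMatrixEval d P₂ fun j => ξ j) := fun ξ => hP₂ _
  -- The dense set is the union of the ranges of all `φ(A)`; the same set works for every `α`.
  refine ⟨h₁.isClosable hR, h₂.isClosable hR, _, hR.dense_range_calcM m, ?_⟩
  rintro x ⟨φ, hφ, y, rfl⟩
  obtain ⟨ψ, hψ, hφψ⟩ := hφ.exists_mul_eq
  have hsol := DegenerateFractional.isSolution_mittagLeffler hR (h₁.closure hR) (h₂.closure hR) hu₂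
    hφ hψ hφψ hα y
  exact ⟨_, hsol, fun v hv => hv.eqOn hR (h₁.closure hR) (h₂.closure hR) hu₂ hα hsol,
    DegenerateFractional.exists_analytic_extension hα _ _ y⟩
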